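/- Let $d\ge 1$, let $N\ge 0$ be an integer and let $\mathcal H=(h_j)_{j\ge 0}$ be a sequence of positive integers. Write $\|\cdot\|$ for the Euclidean norm, $\mathbb B(x,r)=\{y\in\mathbb Z^d:\|y-x\|<r\}$, $\mathbb A(r,R)=\mathbb B(0,R)\setminus\mathbb B(0,r)$, and $\partial\Lambda$ for the set of sites outside $\Lambda\subset\mathbb Z^d$ having a nearest neighbour in $\Lambda$. For a nearest-neighbour trajectory $S$ let $H(\Lambda;S)=\inf\{t\ge 0: S(t)\in\Lambda\}$ (with $\inf\emptyset=\infty$). "Simple random walk" means simple random walk on $\mathbb Z^d$ started at $0$. **Cluster growth.** Given trajectories $S_1,\dots,S_N$ and sets $F_1,\dots,F_N\subset\mathbb N$ of allowed times, put $A(0)=\emptyset$, $\tau_i=\inf\{t\in F_i: S_i(t)\notin A(i-1)\}$ and $A(i)=A(i-1)\cup\{S_i(\tau_i)\}$ (nothing is added if $\tau_i=\infty$). *Internal DLA* is the case where the $S_i$ are independent simple random walks and $F_i=\mathbb N$ for all $i$. **The $\mathcal H$-flashing process.** Let $r_0=0$ and $r_{j+1}=r_j+h_j+h_{j+1}$;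 let $\mathcal S_j=\mathbb A(r_j-h_j,r_j+h_j)$ (so $\mathcal S_0=\mathbb B(0,h_0)$), $\Sigma_0=\{0\}$ and $\Sigma_j=\partial\mathbb B(0,r_j)$ for $j\ge 1$. For $z\in\Sigma_j$ the cell $\mathcal C(z)$ is the set of $x\in\mathcal S_j$ of the form $x=\lambda y$ with $\lambda\ge0$, $y\in\mathbb R^d$, $\|y-z\|<h_j/2$. Let $S_1,\dots,S_N$ be independent simple random walks and, independently of them, let $X_{i,j},Y_{i,j},R_{i,j}$ ($1\le i\le N$, $j\ge 0$) be mutually independent, $X_{i,j},Y_{i,j}$ Bernoulli with $P(X_{i,j}=1)=h_j^{-d}$, $P(Y_{i,0}=1)=1$, $P(Y_{i,j}=1)=\tfrac12$ for $j\ge1$, and $R_{i,j}$ with density $d\,a^{d-1}/h_j^d$ on $[0,h_j]$. Let $H_{i,j}=H(\Sigma_j;S_i)$, $z_{i,j}=S_i(H_{i,j})$, $S'=S_i(H_{i,j}+\cdot)$ and $\sigma_{i,j}=H_{i,j}+\sigma$, where $$\sigma=\begin{cases}0 & X_{i,j}=1,\\ H\big(\mathbb B(z_{i,j},R_{i,j}\wedge(r_j+h_j-\|z_{i,j}\|))^c;S'\big)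 & X_{i,j}=0,\ Y_{i,j}=1,\\ H\big(\mathbb A(r_j-R_{i,j},r_j+R_{i,j})^c;S'\big) & X_{i,j}=0,\ Y_{i,j}=0.\end{cases}$$ The flashing times of explorer $i$ are the finite $\sigma_{i,j}$, $j\ge0$, for which $S_i(\sigma_{i,j})\in\mathcal C(z_{i,j})$. The $\mathcal H$-flashing process $A^*(0),\dots,A^*(N)$, with settling times $\tau^*_1,\dots,\tau_N^*$, is the cluster growth in which $F_i$ is the set of flashing times of explorer $i$. **Claim.** There is a coupling of the two processes using the same trajectories. That is, on some probability space there are an internal DLA process $A(0),\dots,A(N)$, driven by independent simple random walks $W_1,\dots,W_N$ and with settling times $\tau_1,\dots,\tau_N$, an $\mathcal H$-flashing process $A^*(0),\dots,A^*(N)$ driven by independent simple random walks $S_1,\dots,S_N$ (and its variables $X,Y,R$), and $\mathbb N$-valued random variables $T(i),T^*(i)$, $1\le i\le N$, such that almost surely: * $\tau_i<\infty$ and $\tau^*_i=T^*(i)<\infty$ for every $i$; * $A(N)=\bigcup_{i=1}^N\{S_i(T(i))\}$ and $A^*(N)=\bigcup_{i=1}^N\{S_i(T^*(i))\}$; * $T^*(i)\ge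 T(i)$ for every $i=1,\dots,N$; * the internal DLA explorers, up to settling, make exactly the steps that the trajectories $S_k$ make up to the times $T(k)$: there is a bijection from $\{(i,t):0\le t<\tau_i\}$ to $\{(k,u):0\le u<T(k)\}$ such that $(W_i(t),W_i(t+1))=(S_k(u),S_k(u+1))$ whenever $(i,t)$ is mapped to $(k,u)$. -/

import Mathlib

open MeasureTheory ProbabilityTheory

noncomputable section

namespace FlashDLA

/-! ### The lattice -/

/-- The lattice `ℤ^d`. -/
abbrev V (d : ℕ) : Type := Fin d → ℤ

/-- The inclusion of `ℤ^d` in Euclidean space `ℝ^d`. -/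
def emb {d : ℕ} (z : V d) : EuclideanSpace ℝ (Fin d) :=
  WithLp.toLp 2 (fun i => (z i : ℝ))

/-- Nearest neighbours in `ℤ^d`: Euclidean distance one. -/
def Nbr {d : ℕ} (z z' : V d) : Prop := ‖emb z - emb z'‖ = 1

/-- The sites of the open Euclidean ball with center `x` and radius `r`. -/
def dBall {d : ℕ} (x : V d) (r : ℝ) : Set (V d) := {y | ‖emb y - emb x‖ < r}

/-- The discrete annulus `{z : r ≤ ‖z‖ < R}`. -/
def dAnnulus (d : ℕ) (r R : ℝ) : Set (V d) := dBall 0 R \ dBall 0 r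

/-- The outer boundary of a set of sites. -/
def bdry {d : ℕ} (L : Set (V d)) : Set (V d) := {z | z ∉ L ∧ ∃ z' ∈ L, Nbr z' z}

/-! ### Cluster growth -/

/-- `inf {t : Q t}`, equal to `⊤` when no `t` satisfies `Q`. -/
def firstTime (Q : ℕ → Prop) : ℕ∞ := sInf ((fun t : ℕ => (t : ℕ∞)) '' {t | Q t})

/-- The hitting time of a set of sites by a trajectory. -/
def hitTime {d : ℕ} (L : Set (V d)) (s : ℕ → V d) : ℕ∞ := firstTime (fun t => s t ∈ L)

/-- The settling time of an explorer with trajectory `s` that may settle only at the times in `F`,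
when the sites of `A` are occupied. -/
def settleTime {d : ℕ} (s : ℕ → V d) (F : Set ℕ) (A : Set (V d)) : ℕ∞ :=
  firstTime (fun t => t ∈ F ∧ s t ∉ A)

/-- The cluster after the first `k` explorers, explorer `i` having the trajectory `s i` and being
allowed to settle only at the times in `F i`. Explorers are labelled by `Fin N`, so that the
explorer with label `i` is launched when the cluster is `cluster s F i`. An explorer that never
settles contributes no site. -/
def cluster {d N : ℕ} (s : Fin N → ℕ → V d) (F : Fin N → Set ℕ) : ℕ → Set (V d)
  | 0 => ∅
  | k + 1 => cluster s F k ∪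
      {x | ∃ (hk : k < N) (t : ℕ),
        settleTime (s ⟨k, hk⟩) (F ⟨k, hk⟩) (cluster s F k) = (t : ℕ∞) ∧ s ⟨k, hk⟩ t = x}

/-- The settling time of the explorer with label `i` in the cluster growth above. -/
def settlingTime {d N : ℕ} (s : Fin N → ℕ → V d) (F : Fin N → Set ℕ) (i : Fin N) : ℕ∞ :=
  settleTime (s i) (F i) (cluster s F i)

/-- Internal DLA: explorers may settle at all times. -/
def idlaCluster {d N : ℕ} (s : Fin N → ℕ → V d) : ℕ → Set (V d) :=
  cluster s (fun _ => Set.univ)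

/-- The settling times of internal DLA. -/
def idlaTime {d N : ℕ} (s : Fin N → ℕ → V d) (i : Fin N) : ℕ∞ :=
  settlingTime s (fun _ => Set.univ) i

/-! ### Shells, cells and flashing times for a sequence of widths -/

/-- The radii `r_j`: `r_0 = 0` and `r_{j+1} - h_{j+1} = r_j + h_j`. -/
def shellRadius (h : ℕ → ℕ) : ℕ → ℝ
  | 0 => 0
  | j + 1 => shellRadius h j + h j + h (j + 1)

/-- The shell `S_j`; for `j = 0` this is the ball of radius `h_0`. -/
def shell (d : ℕ) (h : ℕ → ℕ) (j : ℕ) : Set (V d) :=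
  dAnnulus d (shellRadius h j - h j) (shellRadius h j + h j)

/-- The site set `Σ_j`: the origin for `j = 0`, the boundary of the ball of radius `r_j`
for `j ≥ 1`. -/
def midSphere (d : ℕ) (h : ℕ → ℕ) : ℕ → Set (V d)
  | 0 => {0}
  | j + 1 => bdry (dBall 0 (shellRadius h (j + 1)))

/-- The cell of shell `j` centered at `z`: the sites of the shell in the cone generated by the
open ball of `ℝ^d` with center `z` and radius `h_j / 2`. -/
def cell {d : ℕ} (h : ℕ → ℕ) (j : ℕ) (z : V d) : Set (V d) :=
  shell d h j ∩ {x | ∃ l : ℝ, 0 ≤ l ∧ ∃ y ∈ Metric.ball (emb z) ((h j : ℝ) / 2), emb x = l • y}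

/-- The stopping time `σ` for a trajectory `s` started on `Σ_j`, with flags `x`, `y` and
radius `ρ`. -/
def flashDelay {d : ℕ} (h : ℕ → ℕ) (j : ℕ) (x y : Bool) (ρ : ℝ) (s : ℕ → V d) : ℕ∞ :=
  if x = true then 0
  else if y = true then
    hitTime (dBall (s 0) (min ρ (shellRadius h j + h j - ‖emb (s 0)‖)))ᶜ s
  else hitTime (dAnnulus d (shellRadius h j - ρ) (shellRadius h j + ρ))ᶜ s

/-- The flashing times of an explorer with trajectory `s`, flags `x`, `y` and radii `ρ`: the times
`t = σ_j = H_j + σ(s ∘ θ_{H_j})`, where `u = H_j` is the hitting time of `Σ_j`, for which `s t`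
lies in the cell centered at `s u`. -/
def flashTimes {d : ℕ} (h : ℕ → ℕ) (s : ℕ → V d) (x y : ℕ → Bool) (ρ : ℕ → ℝ) : Set ℕ :=
  {t | ∃ j u : ℕ, hitTime (midSphere d h j) s = (u : ℕ∞) ∧
    (u : ℕ∞) + flashDelay h j (x j) (y j) (ρ j) (fun v => s (u + v)) = (t : ℕ∞) ∧
    s t ∈ cell h j (s u)}

/-- The clusters of the flashing process. -/
def flashCluster {d N : ℕ} (h : ℕ → ℕ) (s : Fin N → ℕ → V d) (x y : Fin N → ℕ → Bool)
    (ρ : Fin N → ℕ → ℝ) : ℕ → Set (V d) :=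
  cluster s (fun i => flashTimes h (s i) (x i) (y i) (ρ i))

/-- The settling times of the flashing process. -/
def flashTime {d N : ℕ} (h : ℕ → ℕ) (s : Fin N → ℕ → V d) (x y : Fin N → ℕ → Bool)
    (ρ : Fin N → ℕ → ℝ) (i : Fin N) : ℕ∞ :=
  settlingTime s (fun i => flashTimes h (s i) (x i) (y i) (ρ i)) i

/-! ### The random inputs -/

/-- `S` is a family of `N` independent simple random walks on `ℤ^d` started at the origin: the
increments are independent and uniform on the nearest neighbours of the origin. -/
structure IsWalkFamily {d N : ℕ} {Ω : Type*} [MeasurableSpace Ω] (P : Measure Ω)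
    (S : Fin N → ℕ → Ω → V d) : Prop where
  measurable : ∀ i t, Measurable (S i t)
  start : ∀ i ω, S i 0 ω = 0
  law : ∀ i t, P.map (fun ω => S i (t + 1) ω - S i t ω) = uniformOn {e : V d | Nbr e 0}
  indep : iIndepFun (fun (p : Fin N × ℕ) ω => S p.1 (p.2 + 1) ω - S p.1 p.2 ω) P

theorem inv_pow_mem (m d : ℕ) : ((m : ℝ) ^ d)⁻¹ ∈ unitInterval :=
  ⟨by positivity, by exact_mod_cast Nat.cast_inv_le_one (α := ℝ) (m ^ d)⟩

theorem half_mem : (1 / 2 : ℝ) ∈ unitInterval := ⟨by norm_num, by norm_num⟩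

/-- The law of `X_j`: `true` (one) with probability `1 / h_j ^ d`. -/
def lawX (d : ℕ) (h : ℕ → ℕ) (j : ℕ) : Measure Bool :=
  bernoulliMeasure true false ⟨((h j : ℝ) ^ d)⁻¹, inv_pow_mem (h j) d⟩

/-- The law of `Y_j`: `true` (one) with probability `1` for `j = 0` and `1 / 2` for `j ≥ 1`. -/
def lawY : ℕ → Measure Bool
  | 0 => bernoulliMeasure true false 1
  | _ + 1 => bernoulliMeasure true false ⟨1 / 2, half_mem⟩

/-- The law of `R_j`: density `d h ^ (d - 1) / h_j ^ d` on `[0, h_j]`. -/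
def lawR (d : ℕ) (h : ℕ → ℕ) (j : ℕ) : Measure ℝ :=
  (volume.restrict (Set.Icc 0 (h j : ℝ))).withDensity
    (fun a => ENNReal.ofReal ((d : ℝ) * a ^ (d - 1) / (h j : ℝ) ^ d))

/-- The random input of the flashing process: `N` independent simple random walks and, independent
of them, mutually independent variables `X i j`, `Y i j`, `R i j` with the laws above. -/
structure IsFlashingInput {d N : ℕ} (h : ℕ → ℕ) {Ω : Type*} [MeasurableSpace Ω] (P : Measure Ω)
    (S : Fin N → ℕ → Ω → V d) (X Y : Fin N → ℕ → Ω → Bool) (R : Fin N → ℕ → Ω → ℝ) :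
    Prop where
  walks : IsWalkFamily P S
  measurable_X : ∀ i j, Measurable (X i j)
  measurable_Y : ∀ i j, Measurable (Y i j)
  measurable_R : ∀ i j, Measurable (R i j)
  law : ∀ i j, P.map (fun ω => (X i j ω, Y i j ω, R i j ω)) =
    (lawX d h j).prod ((lawY j).prod (lawR d h j))
  indep : iIndepFun (fun (p : Fin N × ℕ) ω => (X p.1 p.2 ω, Y p.1 p.2 ω, R p.1 p.2 ω)) P
  indep_walks : IndepFun (fun ω i t => S i t ω)
    (fun ω i j => ((X i j ω, Y i j ω, R i j ω) : Bool × Bool × ℝ)) P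

/-- The journeys of internal DLA explorers with trajectories `w` and settling times `τ` are made of
the trajectories `s`, where `s i` is followed up to time `T i`: there is a bijection between the
steps `w i t → w i (t+1)`, `t < τ i`, and the steps `s k u → s k (u+1)`, `u < T k`, and
corresponding steps are equal. -/
def SameSteps {d N : ℕ} (w : Fin N → ℕ → V d) (τ : Fin N → ℕ∞) (s : Fin N → ℕ → V d)
    (T : Fin N → ℕ) : Prop :=
  ∃ f : Fin N × ℕ → Fin N × ℕ,
    Set.BijOn f {p | (p.2 : ℕ∞) < τ p.1} {q | q.2 < T q.1} ∧
    ∀ p : Fin N × ℕ, (p.2 : ℕ∞) < τ p.1 →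
      w p.1 p.2 = s (f p).1 (f p).2 ∧ w p.1 (p.2 + 1) = s (f p).1 ((f p).2 + 1)

end FlashDLA

end

/-!
The coupling rests on a variant of the abelian property of internal DLA. All `N` explorers of the
flashing process start at the origin, and the internal DLA explorers are carried by their
trajectories: whenever two labels sit on the same site, one of them makes a step of its own
trajectory, and the internal DLA explorer on its way makes this step; when the labels sit on
distinct sites, that explorer has settled, and the next label is activated (`explore`, `Carries`).

The label that moves is chosen so that it never passes its settling time in the flashing process.
If, of two labels at a site, some are not at a flashing time, one of these moves; if both are at
a flashing time, the larger label moves, because the smaller one has priority: at this time, it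
settles there unless it finds the site occupied, and in both cases the larger label cannot settle
there (`succ_le_settlingTime`). Hence `T i ≤ T* i`, and the exploration terminates as soon as the
flashing explorers all settle (`exists_explore_done`). The shells and the cells play no role here:
this part is written for arbitrary sets of allowed times, and the next one for adapted ones.

Whether a label is at a flashing time is decided by the part of its trajectory already explored, so
every step read by an internal DLA explorer is fresh. To see that the trajectories so obtained are
independent simple random walks, reserve independent increments for them, and at each step exchange
the increment read with the increment reserved for this step. The choice of the exchange does not
depend on the two increments exchanged, so it preserves the product measure
(`measurePreserving_of_invariant_choice`, `measurePreserving_rearrange`), and so does the limit of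
the rearrangements, which are eventually constant (`measurePreserving_finalRearrange`).

Flashing explorers settle almost surely (`ae_settleTime_flashTimes_ne_top`): simple random walk is
unbounded, since it makes arbitrarily long runs of equal steps, so it meets all shells; in each of
them the flags and the radius make it flash with a probability bounded below, independently of the
other shells (`le_measure_triggers`), and only finitely many shells contain occupied sites.
-/

noncomputable section

namespace FlashDLA

/-! ### First times -/

theorem firstTime_eq_coe_iff {Q : ℕ → Prop} {t : ℕ} :
    firstTime Q = (t : ℕ∞) ↔ Q t ∧ ∀ u < t, ¬ Q u := by
  constructor
  · intro h
    have hne : ((fun t : ℕ => (t : ℕ∞)) '' {t | Q t}).Nonempty := by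
      by_contra hn
      rw [Set.not_nonempty_iff_eq_empty] at hn
      rw [firstTime, hn, sInf_empty] at h
      exact ENat.top_ne_natCast t h
    obtain ⟨u, hu, hut⟩ := csInf_mem hne
    have e : u = t := by
      have : (u : ℕ∞) = t := hut.trans h
      exact_mod_cast this
    subst e
    refine ⟨hu, fun v hv hQ => ?_⟩
    have : firstTime Q ≤ (v : ℕ∞) := sInf_le ⟨v, hQ, rfl⟩
    rw [h] at this
    exact absurd (by exact_mod_cast this : u ≤ v) (by omega)
  · rintro ⟨hQ, hmin⟩
    refine le_antisymm (sInf_le ⟨t, hQ, rfl⟩) (le_sInf ?_)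
    rintro _ ⟨u, hu, rfl⟩
    have : t ≤ u := by
      by_contra hlt
      exact hmin u (by omega) hu
    exact Nat.cast_le.2 this

theorem firstTime_le {Q : ℕ → Prop} {t : ℕ} (h : Q t) : firstTime Q ≤ (t : ℕ∞) :=
  sInf_le ⟨t, h, rfl⟩

theorem firstTime_ne_top_iff {Q : ℕ → Prop} : firstTime Q ≠ ⊤ ↔ ∃ t, Q t := by
  constructor
  · intro h
    obtain ⟨t, ht⟩ := ENat.ne_top_iff_exists.1 h
    exact ⟨t, (firstTime_eq_coe_iff.1 ht.symm).1⟩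
  · rintro ⟨t, ht⟩ h
    have := firstTime_le ht
    rw [h] at this
    exact ENat.natCast_ne_top t (top_le_iff.1 this)

section Exploration

/-! ### Cluster growth -/

variable {d N : ℕ}

theorem cluster_mono {s : Fin N → ℕ → V d} {F : Fin N → Set ℕ} : Monotone (cluster s F) :=
  monotone_nat_of_le_succ fun _ => Set.subset_union_left

theorem cluster_succ_of_settlingTime_eq {s : Fin N → ℕ → V d} {F : Fin N → Set ℕ} {i : Fin N}
    {t : ℕ} (h : settlingTime s F i = t) :
    cluster s F (i + 1) = cluster s F i ∪ {s i t} := by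
  rw [cluster]
  congr 1
  ext x
  simp only [Set.mem_ofPred_eq, Set.mem_singleton_iff]
  constructor
  · rintro ⟨_, u, hu, rfl⟩
    have : (u : ℕ∞) = t := hu.symm.trans h
    rw [(by exact_mod_cast this : u = t)]
  · rintro rfl
    exact ⟨i.2, t, h, rfl⟩

theorem cluster_finite (s : Fin N → ℕ → V d) (F : Fin N → Set ℕ) (k : ℕ) :
    (cluster s F k).Finite := by
  induction k with
  | zero => exact Set.finite_empty
  | succ k ih =>
    refine ih.union (Set.Subsingleton.finite ?_)
    rintro x ⟨hk, t, ht, rfl⟩ y ⟨_, u, hu, rfl⟩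
    rw [(by exact_mod_cast ht.symm.trans hu : t = u)]

/-- When every explorer settles, the final cluster is the set of the settling sites. -/
theorem cluster_eq_iUnion {s : Fin N → ℕ → V d} {F : Fin N → Set ℕ} {τ : Fin N → ℕ}
    (h : ∀ i, settlingTime s F i = τ i) : cluster s F N = ⋃ i, {s i (τ i)} := by
  have key : ∀ k ≤ N, cluster s F k = {x | ∃ i : Fin N, (i : ℕ) < k ∧ s i (τ i) = x} := by
    intro k
    induction k with
    | zero => intro _; simp [cluster]
    | succ k ih =>
      intro hk
      rw [cluster_succ_of_settlingTime_eq (i := ⟨k, hk⟩) (h _), ih (by omega)]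
      ext x
      simp only [Set.mem_union, Set.mem_ofPred_eq, Set.mem_singleton_iff]
      constructor
      · rintro (⟨i, hi, rfl⟩ | rfl)
        · exact ⟨i, by omega, rfl⟩
        · exact ⟨⟨k, hk⟩, by simp, rfl⟩
      · rintro ⟨i, hi, rfl⟩
        rcases Nat.lt_succ_iff_lt_or_eq.1 hi with hlt | rfl
        · exact Or.inl ⟨i, hlt, rfl⟩
        · exact Or.inr rfl
  rw [key N le_rfl]
  ext x
  simp [eq_comm]

/-- A site visited at an allowed time before settling is occupied once the explorer is done. -/
theorem mem_cluster_succ_of_le_settlingTime {s : Fin N → ℕ → V d} {F : Fin N → Set ℕ} {i : Fin N}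
    {t : ℕ} (ht : t ∈ F i) (hle : (t : ℕ∞) ≤ settlingTime s F i) :
    s i t ∈ cluster s F (i + 1) := by
  by_cases hm : s i t ∈ cluster s F i
  · exact Or.inl hm
  · have : settlingTime s F i = t := le_antisymm (firstTime_le ⟨ht, hm⟩) hle
    rw [cluster_succ_of_settlingTime_eq this]
    exact Or.inr rfl

/-! ### The exploration -/

/-- A state `(k, T, n)` of the exploration: the number `k` of internal DLA explorers that have
settled, the times `T i` reached on the trajectories `s i`, and the numbers `n i` of steps made by
the internal DLA explorers. The labels `i ≤ k` are active, explorer `k` is on its way, and the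
exploration is over when `k = N`. -/
abbrev State (N : ℕ) : Type := ℕ × (Fin N → ℕ) × (Fin N → ℕ)

/-- Label `m` may be moved, when the labels `i ≤ k` are active, at the sites `pos i`, and `fl i`
tells whether `i` is at an allowed time: it shares its site with another active label `b`, and
either it is not at an allowed time or `b` has priority over it, being smaller and at an allowed
time. -/
def IsMover (k : ℕ) (pos : Fin N → V d) (fl : Fin N → Bool) (m : Fin N) : Prop :=
  (m : ℕ) ≤ k ∧ ∃ b : Fin N, (b : ℕ) ≤ k ∧ b ≠ m ∧ pos b = pos m ∧
    (fl m = false ∨ (b < m ∧ fl b = true))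

open Classical in
/-- The next step of the exploration from a state, given the sites of the labels and the flags
telling who is at an allowed time: a pair `(a, p)` means that the internal DLA step `p.2` of
explorer `p.1` is the step `a.2` of the trajectory `a.1`; `none` means that the current explorer
has settled. -/
def nextMove (st : State N) (pos : Fin N → V d) (fl : Fin N → Bool) :
    Option ((Fin N × ℕ) × (Fin N × ℕ)) :=
  if hk : st.1 < N then
    if h : ∃ m, IsMover st.1 pos fl m then
      some ((h.choose, st.2.1 h.choose), (⟨st.1, hk⟩, st.2.2 ⟨st.1, hk⟩))
    else none
  else none

/-- The effect of a step on the state: a move `(a, p)` advances by one the time on trajectory `a.1`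
and the number of steps of explorer `p.1`; without a move, the number of settled explorers goes up,
and stays equal to `N` once it is. -/
def State.apply (st : State N) : Option ((Fin N × ℕ) × (Fin N × ℕ)) → State N
  | some c => (st.1, Function.update st.2.1 c.1.1 (c.1.2 + 1),
      Function.update st.2.2 c.2.1 (c.2.2 + 1))
  | none => (min (st.1 + 1) N, st.2.1, st.2.2)

open Classical in
/-- The next step of the exploration of the trajectories `s` with allowed times `F`. -/
def moveAt (s : Fin N → ℕ → V d) (F : Fin N → Set ℕ) (st : State N) :
    Option ((Fin N × ℕ) × (Fin N × ℕ)) :=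
  nextMove st (fun i => s i (st.2.1 i)) (fun i => decide (st.2.1 i ∈ F i))

/-- The states of the exploration. -/
def explore (s : Fin N → ℕ → V d) (F : Fin N → Set ℕ) : ℕ → State N
  | 0 => (0, 0, 0)
  | n + 1 => (explore s F n).apply (moveAt s F (explore s F n))

variable {s : Fin N → ℕ → V d} {F : Fin N → Set ℕ}

/-- Of two active labels at the same site, one may always be moved: the larger one if the smaller
one is at an allowed time, and the smaller one otherwise. -/
theorem exists_isMover_iff {k : ℕ} {pos : Fin N → V d} {fl : Fin N → Bool} :
    (∃ m, IsMover k pos fl m) ↔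
      ∃ a b : Fin N, (a : ℕ) ≤ k ∧ (b : ℕ) ≤ k ∧ b ≠ a ∧ pos b = pos a := by
  constructor
  · rintro ⟨m, hm, b, hb, hne, hp, -⟩
    exact ⟨m, b, hm, hb, hne, hp⟩
  · have key : ∀ a b : Fin N, (a : ℕ) ≤ k → (b : ℕ) ≤ k → a < b → pos b = pos a →
        ∃ m, IsMover k pos fl m := by
      intro a b ha hb hlt hp
      cases hfa : fl a
      · exact ⟨a, ha, b, hb, hlt.ne', hp, Or.inl hfa⟩
      · exact ⟨b, hb, a, ha, hlt.ne, hp.symm, Or.inr ⟨hlt, hfa⟩⟩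
    rintro ⟨a, b, ha, hb, hne, hp⟩
    rcases lt_or_gt_of_ne hne with h | h
    · exact key b a hb ha h hp.symm
    · exact key a b ha hb h hp

/-- A move reads the first unexplored step of the trajectory of an active label, for the explorer on
its way; another active label is at the same site, with priority if the mover is at an allowed
time. -/
theorem moveAt_eq_some {st : State N} {a p : Fin N × ℕ} (h : moveAt s F st = some (a, p)) :
    a.2 = st.2.1 a.1 ∧ (p.1 : ℕ) = st.1 ∧ p.2 = st.2.2 p.1 ∧ (a.1 : ℕ) ≤ st.1 ∧
      ∃ b : Fin N, (b : ℕ) ≤ st.1 ∧ b ≠ a.1 ∧ s b (st.2.1 b) = s a.1 a.2 ∧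
        (a.2 ∉ F a.1 ∨ (b < a.1 ∧ st.2.1 b ∈ F b)) := by
  unfold moveAt nextMove at h
  split_ifs at h with hk hm
  simp only [Option.some.injEq, Prod.mk.injEq] at h
  obtain ⟨rfl, rfl⟩ := h
  obtain ⟨h1, b, hb, hne, hp, hf⟩ := hm.choose_spec
  refine ⟨rfl, rfl, rfl, h1, b, hb, hne, hp, ?_⟩
  simpa using hf

theorem moveAt_eq_none {st : State N} (hk : st.1 < N) (h : moveAt s F st = none) (a b : Fin N)
    (ha : (a : ℕ) ≤ st.1) (hb : (b : ℕ) ≤ st.1) (hp : s a (st.2.1 a) = s b (st.2.1 b)) :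
    a = b := by
  by_contra hne
  unfold moveAt nextMove at h
  rw [dif_pos hk, dif_pos (exists_isMover_iff.2 ⟨b, a, hb, ha, hne, hp⟩)] at h
  cases h

theorem moveAt_of_le {st : State N} (hk : N ≤ st.1) : moveAt s F st = none := by
  unfold moveAt nextMove
  rw [dif_neg (by omega)]

theorem explore_succ_of_some {n : ℕ} {a p : Fin N × ℕ}
    (h : moveAt s F (explore s F n) = some (a, p)) :
    explore s F (n + 1) = ((explore s F n).1, Function.update (explore s F n).2.1 a.1 (a.2 + 1),
      Function.update (explore s F n).2.2 p.1 (p.2 + 1)) := by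
  rw [explore, h]; rfl

theorem explore_succ_of_none {n : ℕ} (h : moveAt s F (explore s F n) = none) :
    explore s F (n + 1) =
      (min ((explore s F n).1 + 1) N, (explore s F n).2.1, (explore s F n).2.2) := by
  rw [explore, h]; rfl

theorem le_update_self_succ {f : Fin N → ℕ} {i : Fin N} : f ≤ Function.update f i (f i + 1) := by
  intro j
  by_cases h : j = i
  · subst h; simp
  · simp [h]

theorem explore_mono_time : Monotone fun n => (explore s F n).2.1 := by
  refine monotone_nat_of_le_succ fun n => ?_
  rcases h : moveAt s F (explore s F n) with _ | ⟨a, p⟩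
  · simp only [explore_succ_of_none h]; rfl
  · simp only [explore_succ_of_some h, (moveAt_eq_some h).1]
    exact le_update_self_succ

theorem explore_mono_steps : Monotone fun n => (explore s F n).2.2 := by
  refine monotone_nat_of_le_succ fun n => ?_
  rcases h : moveAt s F (explore s F n) with _ | ⟨a, p⟩
  · simp only [explore_succ_of_none h]; rfl
  · simp only [explore_succ_of_some h, (moveAt_eq_some h).2.2.1]
    exact le_update_self_succ

open Classical in
theorem moveAt_congr {s' : Fin N → ℕ → V d} {F' : Fin N → Set ℕ} {st : State N}
    (hs : ∀ i, s i (st.2.1 i) = s' i (st.2.1 i))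
    (hF : ∀ i, st.2.1 i ∈ F i ↔ st.2.1 i ∈ F' i) : moveAt s F st = moveAt s' F' st := by
  unfold moveAt
  have h1 : (fun i => s i (st.2.1 i)) = fun i => s' i (st.2.1 i) := funext hs
  have h2 : (fun i => decide (st.2.1 i ∈ F i)) = fun i => decide (st.2.1 i ∈ F' i) :=
    funext fun i => decide_eq_decide.2 (hF i)
  rw [h1, h2]

/-- The exploration is adapted: up to step `n` it depends only on the trajectories and on the
allowed times up to the times reached. -/
theorem explore_congr {s' : Fin N → ℕ → V d} {F' : Fin N → Set ℕ} {n : ℕ}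
    (hs : ∀ i, ∀ u ≤ (explore s F n).2.1 i, s i u = s' i u)
    (hF : ∀ i, ∀ u ≤ (explore s F n).2.1 i, u ∈ F i ↔ u ∈ F' i) :
    ∀ m ≤ n, explore s' F' m = explore s F m := by
  intro m
  induction m with
  | zero => intro _; rfl
  | succ m ih =>
    intro hm
    have hle : ∀ i, (explore s F m).2.1 i ≤ (explore s F n).2.1 i :=
      fun i => explore_mono_time (by omega : m ≤ n) i
    rw [explore, ih (by omega), explore,
      moveAt_congr (s := s) (fun i => hs i _ (hle i)) (fun i => hF i _ (hle i))]

/-! ### The invariant of the exploration -/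

/-- The invariant linking the exploration to internal DLA with trajectories `w`, while explorer `k`
is on its way: up to one label `c`, the active labels sit on distinct sites and fill the internal
DLA cluster `A(k)`; label `c` is where explorer `k` is. -/
def Carries (s w : Fin N → ℕ → V d) (st : State N) (k c : Fin N) : Prop :=
  c ≤ k ∧ (∀ i j : Fin N, i ≤ k → j ≤ k → i ≠ c → j ≠ c →
      s i (st.2.1 i) = s j (st.2.1 j) → i = j) ∧
    (∀ x, x ∈ idlaCluster w k ↔ ∃ i ≤ k, i ≠ c ∧ s i (st.2.1 i) = x) ∧
    s c (st.2.1 c) = w k (st.2.2 k) ∧ ∀ t < st.2.2 k, w k t ∈ idlaCluster w k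

/-- The invariants of a state of the exploration, relative to internal DLA with trajectories `w`
and to the cluster growth with trajectories `s` and allowed times `F`. -/
structure Inv (s : Fin N → ℕ → V d) (F : Fin N → Set ℕ) (w : Fin N → ℕ → V d) (st : State N) :
    Prop where
  le : st.1 ≤ N
  time_zero : ∀ i : Fin N, st.1 < i → st.2.1 i = 0
  steps_zero : ∀ i : Fin N, st.1 < i → st.2.2 i = 0
  carries : ∀ hk : st.1 < N, ∃ c, Carries s w st ⟨st.1, hk⟩ c
  full : st.1 = N → idlaCluster w N = ⋃ i, {s i (st.2.1 i)}
  settled : ∀ i : Fin N, (i : ℕ) < st.1 → idlaTime w i = st.2.2 i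
  time_le : ∀ i, (st.2.1 i : ℕ∞) ≤ settlingTime s F i

theorem inv_zero {w : Fin N → ℕ → V d} (hs0 : ∀ i, s i 0 = 0) (hw0 : ∀ i, w i 0 = 0) :
    Inv s F w (explore s F 0) where
  le := Nat.zero_le N
  time_zero _ _ := rfl
  steps_zero _ _ := rfl
  carries hk := by
    refine ⟨⟨0, hk⟩, le_rfl, ?_, ?_, ?_, ?_⟩
    · intro i j hi _ hic _ _
      exact absurd (le_antisymm hi (Fin.mk_le_of_le_val (Nat.zero_le _))) hic
    · intro x
      refine iff_of_false (by exact fun h => h) ?_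
      rintro ⟨i, hi, hic, -⟩
      exact absurd (le_antisymm hi (Fin.mk_le_of_le_val (Nat.zero_le _))) hic
    · exact (hs0 _).trans (hw0 _).symm
    · exact fun t ht => absurd ht (Nat.not_lt_zero t)
  full h := by
    change 0 = N at h
    subst h
    simp [idlaCluster, cluster]
  settled i hi := absurd hi (Nat.not_lt_zero _)
  time_le i := by exact bot_le

/-- The mover does not pass its settling time: if it is at an allowed time, the label with priority
over it shows that its site is occupied. -/
theorem succ_le_settlingTime {st : State N} {a p : Fin N × ℕ} (h : moveAt s F st = some (a, p))
    (hle : ∀ i, (st.2.1 i : ℕ∞) ≤ settlingTime s F i) :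
    ((a.2 + 1 : ℕ) : ℕ∞) ≤ settlingTime s F a.1 := by
  obtain ⟨ha, -, -, -, b, -, -, hpos, hf⟩ := moveAt_eq_some h
  have h1 : (a.2 : ℕ∞) ≤ settlingTime s F a.1 := ha ▸ hle a.1
  have h2 : settlingTime s F a.1 ≠ (a.2 : ℕ∞) := by
    intro he
    obtain ⟨⟨hF, hnot⟩, -⟩ := firstTime_eq_coe_iff.1 he
    rcases hf with hf | ⟨hlt, hb⟩
    · exact hf hF
    · exact hnot (hpos ▸ cluster_mono (show (b : ℕ) + 1 ≤ a.1 from hlt)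
        (mem_cluster_succ_of_le_settlingTime hb (hle b)))
  have h3 := lt_of_le_of_ne h1 h2.symm
  rw [Nat.cast_add, Nat.cast_one]
  exact Order.add_one_le_of_lt h3

/-- The label moved shares its site with the label carrying the current explorer, so that it may
carry it in its turn. -/
theorem Carries.of_move {w : Fin N → ℕ → V d} {st : State N} {k c : Fin N} (hkk : st.1 = k)
    (hc : Carries s w st k c) {a p : Fin N × ℕ} (h : moveAt s F st = some (a, p)) :
    Carries s w st k a.1 ∧ w k (st.2.2 k) ∈ idlaCluster w k := by
  obtain ⟨h1, hinj, him, hpc, hlt⟩ := hc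
  obtain ⟨ha, -, -, hak, b, hbk, hba, hpos, -⟩ := moveAt_eq_some h
  rw [ha] at hpos
  have hak' : a.1 ≤ k := by rw [Fin.le_def]; omega
  have hbk' : b ≤ k := by rw [Fin.le_def]; omega
  by_cases hac : a.1 = c
  · subst hac
    exact ⟨⟨h1, hinj, him, hpc, hlt⟩, hpc ▸ (him _).2 ⟨b, hbk', hba, hpos⟩⟩
  · have hbc : b = c := by
      by_contra hbc
      exact hba (hinj b a.1 hbk' hak' hbc hac hpos)
    subst hbc
    refine ⟨⟨hak', ?_, ?_, hpos ▸ hpc, hlt⟩, hpc ▸ (him _).2 ⟨a.1, hak', hac, hpos.symm⟩⟩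
    · intro i j hi hj hia hja hij
      by_cases hib : i = b
      · subst hib
        by_contra hne
        exact hja (hinj j a.1 hj hak' (Ne.symm hne) hac (hij.symm.trans hpos))
      · by_cases hjb : j = b
        · subst hjb
          by_contra hne
          exact hia (hinj i a.1 hi hak' hne hac (hij.trans hpos))
        · exact hinj i j hi hj hib hjb hij
    · intro x
      rw [him x]
      constructor
      · rintro ⟨i, hi, hib, rfl⟩
        by_cases hia : i = a.1
        · subst hia
          exact ⟨b, hbk', hba, hpos⟩
        · exact ⟨i, hi, hia, rfl⟩
      · rintro ⟨i, hi, hia, rfl⟩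
        by_cases hib : i = b
        · subst hib
          exact ⟨a.1, hak', hac, hpos.symm⟩
        · exact ⟨i, hi, hib, rfl⟩

/-- A move preserves the invariants, and both explorers are at the same sites before and after the
step. -/
theorem Inv.step_some {w : Fin N → ℕ → V d} {n : ℕ} (hI : Inv s F w (explore s F n))
    {a p : Fin N × ℕ} (h : moveAt s F (explore s F n) = some (a, p))
    (hw : w p.1 (p.2 + 1) - w p.1 p.2 = s a.1 (a.2 + 1) - s a.1 a.2) :
    Inv s F w (explore s F (n + 1)) ∧ w p.1 p.2 = s a.1 a.2 ∧
      w p.1 (p.2 + 1) = s a.1 (a.2 + 1) := by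
  obtain ⟨ha, hp1, hp2, hak, -⟩ := moveAt_eq_some h
  rw [explore_succ_of_some h]
  generalize explore s F n = st at *
  obtain ⟨k, T, tW⟩ := st
  simp only at *
  have hk : k < N := hp1 ▸ p.1.2
  have hpk : p.1 = ⟨k, hk⟩ := Fin.ext hp1
  obtain ⟨c, hc⟩ := hI.carries hk
  obtain ⟨⟨h1, hinj, him, hpc, hlt⟩, hmem⟩ := hc.of_move rfl h
  simp only at *
  obtain ⟨m, u⟩ := a
  obtain ⟨q, t⟩ := p
  simp only at *
  subst hpk ha hp2
  have hnext : w ⟨k, hk⟩ (tW ⟨k, hk⟩ + 1) = s m (T m + 1) := by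
    have := congrArg (· + s m (T m)) hw
    simp only [sub_add_cancel] at this
    rw [← this, hpc, sub_add_cancel]
  refine ⟨⟨hI.le, ?_, ?_, ?_, ?_, ?_, ?_⟩, hpc.symm, hnext⟩
  · intro i hi
    have : i ≠ m := by rintro rfl; simp only at hi; omega
    simpa [this] using hI.time_zero i hi
  · intro i hi
    have : i ≠ ⟨k, hk⟩ := by rintro rfl; simp at hi
    simpa [this] using hI.steps_zero i hi
  · intro _
    refine ⟨m, h1, ?_, ?_, ?_, ?_⟩
    · intro i j hi hj him hjm
      simpa [him, hjm] using hinj i j hi hj him hjm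
    · intro x
      rw [him x]
      refine exists_congr fun i => and_congr_right fun _ => and_congr_right fun hi => ?_
      simp [hi]
    · simpa using hnext.symm
    · intro v hv
      simp only [Function.update_self] at hv
      rcases Nat.lt_succ_iff_lt_or_eq.1 hv with hv | rfl
      · exact hlt v hv
      · exact hmem
  · intro he
    simp only at he
    omega
  · intro i hi
    have : i ≠ ⟨k, hk⟩ := by rintro rfl; simp at hi
    simpa [this] using hI.settled i hi
  · intro i
    by_cases him : i = m
    · subst him
      simpa using succ_le_settlingTime h hI.time_le
    · simpa [him] using hI.time_le i

/-- Without a move, the active labels are on distinct sites, so that explorer `k` has reached a free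
site; the invariants hold again with label `k + 1` activated at the origin. -/
theorem Inv.step_none {w : Fin N → ℕ → V d} (hs0 : ∀ i, s i 0 = 0) (hw0 : ∀ i, w i 0 = 0) {n : ℕ}
    (hI : Inv s F w (explore s F n)) (h : moveAt s F (explore s F n) = none) :
    Inv s F w (explore s F (n + 1)) := by
  rw [explore_succ_of_none h]
  by_cases hk : (explore s F n).1 < N
  swap
  · have : (explore s F n).1 = N := le_antisymm hI.le (not_lt.1 hk)
    have e : min ((explore s F n).1 + 1) N = (explore s F n).1 := by omega
    rw [e]
    exact hI
  have hinj := moveAt_eq_none hk h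
  generalize explore s F n = st at *
  obtain ⟨k, T, tW⟩ := st
  simp only at *
  rw [min_eq_left (by omega)]
  obtain ⟨c, hck, -, him, hpc, hlt⟩ := hI.carries hk
  simp only at *
  have hfree : w ⟨k, hk⟩ (tW ⟨k, hk⟩) ∉ idlaCluster w k := by
    rw [← hpc]
    intro hmem
    obtain ⟨i, hi, hic, hpos⟩ := (him _).1 hmem
    exact hic (hinj i c hi hck hpos)
  have hset : idlaTime w ⟨k, hk⟩ = tW ⟨k, hk⟩ :=
    firstTime_eq_coe_iff.2 ⟨⟨trivial, hfree⟩, fun u hu hQ => hQ.2 (hlt u hu)⟩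
  have hcl : ∀ x, x ∈ idlaCluster w (k + 1) ↔ ∃ i : Fin N, (i : ℕ) ≤ k ∧ s i (T i) = x := by
    intro x
    rw [idlaCluster, cluster_succ_of_settlingTime_eq (i := ⟨k, hk⟩) hset]
    change x ∈ idlaCluster w k ∨ x = _ ↔ _
    rw [him x, ← hpc]
    constructor
    · rintro (⟨i, hi, -, rfl⟩ | rfl)
      · exact ⟨i, hi, rfl⟩
      · exact ⟨c, hck, rfl⟩
    · rintro ⟨i, hi, rfl⟩
      by_cases hic : i = c
      · subst hic; exact Or.inr rfl
      · exact Or.inl ⟨i, hi, hic, rfl⟩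
  refine ⟨hk, fun i hi => hI.time_zero i (by simp only at hi ⊢; omega),
    fun i hi => hI.steps_zero i (by simp only at hi ⊢; omega), ?_, ?_, ?_, hI.time_le⟩
  · intro hk1
    simp only at hk1
    have hT : T ⟨k + 1, hk1⟩ = 0 := hI.time_zero ⟨k + 1, hk1⟩ (by simp)
    have ht : tW ⟨k + 1, hk1⟩ = 0 := hI.steps_zero ⟨k + 1, hk1⟩ (by simp)
    have hlk : ∀ i : Fin N, i ≤ ⟨k + 1, hk1⟩ → i ≠ ⟨k + 1, hk1⟩ → (i : ℕ) ≤ k := by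
      intro i hi hne
      have := lt_of_le_of_ne hi hne
      rw [Fin.lt_def] at this
      simp only at this
      omega
    refine ⟨⟨k + 1, hk1⟩, le_rfl, ?_, ?_, ?_, ?_⟩
    · intro i j hi hj hic hjc
      exact hinj i j (hlk i hi hic) (hlk j hj hjc)
    · intro x
      simp only
      rw [hcl x]
      constructor
      · rintro ⟨i, hi, rfl⟩
        refine ⟨i, ?_, ?_, rfl⟩
        · rw [Fin.le_def]; simp only; omega
        · rintro rfl; simp at hi
      · rintro ⟨i, hi, hic, rfl⟩
        exact ⟨i, hlk i hi hic, rfl⟩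
    · simp only [hT, ht, hs0, hw0]
    · intro t h0
      simp only [ht] at h0
      omega
  · intro hN
    simp only at hN
    ext x
    have hx := hcl x
    simp only [hN] at hx
    rw [hx]
    simp only [Set.mem_iUnion, Set.mem_singleton_iff]
    constructor
    · rintro ⟨i, -, rfl⟩; exact ⟨i, rfl⟩
    · rintro ⟨i, rfl⟩; exact ⟨i, by omega, rfl⟩
  · intro i hi
    rcases Nat.lt_succ_iff_lt_or_eq.1 hi with hi | hi
    · exact hI.settled i hi
    · have : i = ⟨k, hk⟩ := Fin.ext hi
      subst this
      exact hset

/-- The steps of the internal DLA trajectories `w` are those assigned to them by the exploration. -/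
def Matches (s : Fin N → ℕ → V d) (F : Fin N → Set ℕ) (w : Fin N → ℕ → V d) : Prop :=
  ∀ n a p, moveAt s F (explore s F n) = some (a, p) →
    w p.1 (p.2 + 1) - w p.1 p.2 = s a.1 (a.2 + 1) - s a.1 a.2

theorem Matches.inv {w : Fin N → ℕ → V d} (hM : Matches s F w) (hs0 : ∀ i, s i 0 = 0)
    (hw0 : ∀ i, w i 0 = 0) (n : ℕ) : Inv s F w (explore s F n) := by
  induction n with
  | zero => exact inv_zero hs0 hw0
  | succ n ih =>
    rcases h : moveAt s F (explore s F n) with _ | ⟨a, p⟩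
    · exact ih.step_none hs0 hw0 h
    · exact (ih.step_some h (hM n a p h)).1

/-! ### Termination -/

/-- The times reached never pass the settling times. -/
theorem explore_time_le (n : ℕ) (i : Fin N) :
    ((explore s F n).2.1 i : ℕ∞) ≤ settlingTime s F i := by
  induction n generalizing i with
  | zero => exact bot_le
  | succ n ih =>
    rcases h : moveAt s F (explore s F n) with _ | ⟨a, p⟩
    · rw [explore_succ_of_none h]; exact ih i
    · rw [explore_succ_of_some h]
      by_cases hi : i = a.1
      · subst hi
        simpa using succ_le_settlingTime h ih
      · simpa [hi] using ih i

theorem explore_fst_le (n : ℕ) : (explore s F n).1 ≤ N := by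
  induction n with
  | zero => exact Nat.zero_le N
  | succ n ih =>
    rcases h : moveAt s F (explore s F n) with _ | ⟨a, p⟩
    · rw [explore_succ_of_none h]; exact min_le_right _ _
    · rw [explore_succ_of_some h]; exact ih

theorem explore_of_done {n : ℕ} (hn : (explore s F n).1 = N) :
    ∀ m, n ≤ m → explore s F m = explore s F n := by
  intro m hm
  induction m, hm using Nat.le_induction with
  | base => rfl
  | succ m _ ih =>
    rw [explore_succ_of_none (moveAt_of_le (by rw [ih, hn])), ih]
    ext1
    · simp only; omega
    · rfl

/-- If all explorers of the cluster growth settle, the exploration terminates. -/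
theorem exists_explore_done (h : ∀ i, settlingTime s F i ≠ ⊤) : ∃ n, (explore s F n).1 = N := by
  choose τ hτ using fun i => ENat.ne_top_iff_exists.1 (h i)
  by_contra! hne
  -- Each step before termination settles an internal DLA explorer or advances on a trajectory.
  have key : ∀ n, (explore s F n).1 + ∑ i, (explore s F n).2.1 i = n := by
    intro n
    induction n with
    | zero => simp [explore]
    | succ n ih =>
      rcases hm : moveAt s F (explore s F n) with _ | ⟨a, p⟩
      · have := explore_fst_le (s := s) (F := F) n
        have := hne n
        rw [explore_succ_of_none hm]
        simp only
        omega
      · have ha := (moveAt_eq_some hm).1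
        rw [explore_succ_of_some hm]
        simp only [Finset.sum_update_of_mem (Finset.mem_univ _), ha]
        have := Finset.add_sum_erase Finset.univ (explore s F n).2.1 (Finset.mem_univ a.1)
        rw [Finset.sdiff_singleton_eq_erase]
        omega
  have hk := key (N + ∑ i, τ i + 1)
  have h1 := explore_fst_le (s := s) (F := F) (N + ∑ i, τ i + 1)
  have h2 : ∑ i, (explore s F (N + ∑ i, τ i + 1)).2.1 i ≤ ∑ i, τ i := by
    refine Finset.sum_le_sum fun i _ => ?_
    have := explore_time_le (s := s) (F := F) (N + ∑ i, τ i + 1) i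
    rw [← hτ i] at this
    exact_mod_cast this
  omega

/-! ### The permutation of the steps -/

/-- The transposition exchanging the step of the trajectory with the step of the internal DLA
explorer, for a step of the exploration. -/
def stepSwap : Option ((Fin N × ℕ) × (Fin N × ℕ)) → Equiv.Perm ((Fin N × ℕ) ⊕ (Fin N × ℕ))
  | some c => Equiv.swap (Sum.inl c.1) (Sum.inr c.2)
  | none => 1

/-- The permutation of the steps made by the exploration up to time `n`: it sends an internal DLA
step to the step of a trajectory that it copies. -/
def stepPerm (s : Fin N → ℕ → V d) (F : Fin N → Set ℕ) :
    ℕ → Equiv.Perm ((Fin N × ℕ) ⊕ (Fin N × ℕ))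
  | 0 => 1
  | n + 1 => stepPerm s F n * stepSwap (moveAt s F (explore s F n))

theorem explore_time_le_succ (n : ℕ) (i : Fin N) :
    (explore s F n).2.1 i ≤ (explore s F (n + 1)).2.1 i :=
  explore_mono_time n.le_succ i

theorem explore_steps_le_succ (n : ℕ) (i : Fin N) :
    (explore s F n).2.2 i ≤ (explore s F (n + 1)).2.2 i :=
  explore_mono_steps n.le_succ i

/-- Steps not yet explored are left in place. -/
theorem stepPerm_fresh (n : ℕ) :
    (∀ a : Fin N × ℕ, (explore s F n).2.1 a.1 ≤ a.2 → stepPerm s F n (Sum.inl a) = Sum.inl a) ∧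
    ∀ p : Fin N × ℕ, (explore s F n).2.2 p.1 ≤ p.2 → stepPerm s F n (Sum.inr p) = Sum.inr p := by
  induction n with
  | zero => exact ⟨fun _ _ => rfl, fun _ _ => rfl⟩
  | succ n ih =>
    rw [stepPerm]
    rcases h : moveAt s F (explore s F n) with _ | ⟨a, p⟩
    · rw [explore_succ_of_none h, stepSwap, mul_one]; exact ih
    · rw [explore_succ_of_some h, stepSwap]
      obtain ⟨ha, -, hp, -⟩ := moveAt_eq_some h
      constructor
      · intro b hb
        have hne : b ≠ a := by rintro rfl; simp at hb
        rw [Equiv.Perm.mul_apply,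
          Equiv.swap_apply_of_ne_of_ne (by simpa using hne) (by simp)]
        refine ih.1 b (le_trans ?_ hb)
        simp only [ha]
        exact le_update_self_succ _
      · intro q hq
        have hne : q ≠ p := by rintro rfl; simp at hq
        rw [Equiv.Perm.mul_apply,
          Equiv.swap_apply_of_ne_of_ne (by simp) (by simpa using hne)]
        refine ih.2 q (le_trans ?_ hq)
        simp only [hp]
        exact le_update_self_succ _

/-- The internal DLA steps made up to time `n` come from moves of the exploration. -/
theorem stepPerm_inr (n : ℕ) (p : Fin N × ℕ) (hp : p.2 < (explore s F n).2.2 p.1) :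
    ∃ a, (∃ m < n, moveAt s F (explore s F m) = some (a, p)) ∧
      stepPerm s F n (Sum.inr p) = Sum.inl a ∧ a.2 < (explore s F n).2.1 a.1 := by
  induction n with
  | zero => exact absurd hp (Nat.not_lt_zero _)
  | succ n ih =>
    have old : p.2 < (explore s F n).2.2 p.1 → stepSwap (moveAt s F (explore s F n)) (Sum.inr p) =
        Sum.inr p → ∃ a, (∃ m < n + 1, moveAt s F (explore s F m) = some (a, p)) ∧
      stepPerm s F (n + 1) (Sum.inr p) = Sum.inl a ∧ a.2 < (explore s F (n + 1)).2.1 a.1 := by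
      intro h1 h2
      obtain ⟨a, ⟨m, hm, ham⟩, h3, h4⟩ := ih h1
      refine ⟨a, ⟨m, by omega, ham⟩, ?_, h4.trans_le (explore_time_le_succ n _)⟩
      rw [stepPerm, Equiv.Perm.mul_apply, h2, h3]
    rcases h : moveAt s F (explore s F n) with _ | ⟨a, q⟩
    · rw [explore_succ_of_none h] at hp
      exact old hp (by rw [h]; rfl)
    · obtain ⟨ha, -, hq, -⟩ := moveAt_eq_some h
      by_cases hpq : p = q
      · subst hpq
        refine ⟨a, ⟨n, by omega, h⟩, ?_, ?_⟩
        · rw [stepPerm, Equiv.Perm.mul_apply, h, stepSwap, Equiv.swap_apply_right,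
            (stepPerm_fresh n).1 a ha.ge]
        · rw [explore_succ_of_some h]; simp
      · refine old ?_ ?_
        · rw [explore_succ_of_some h] at hp
          by_cases h1 : p.1 = q.1
          · have : p.2 ≠ q.2 := fun h2 => hpq (Prod.ext h1 h2)
            simp only [h1, Function.update_self] at hp ⊢
            omega
          · simpa [h1] using hp
        · rw [h, stepSwap]
          exact Equiv.swap_apply_of_ne_of_ne (by simp) (by simpa using hpq)

/-- The steps of the trajectories explored up to time `n` are all used. -/
theorem stepPerm_inl (n : ℕ) (a : Fin N × ℕ) (ha : a.2 < (explore s F n).2.1 a.1) :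
    ∃ p : Fin N × ℕ, p.2 < (explore s F n).2.2 p.1 ∧
      stepPerm s F n (Sum.inr p) = Sum.inl a := by
  induction n with
  | zero => exact absurd ha (Nat.not_lt_zero _)
  | succ n ih =>
    rcases h : moveAt s F (explore s F n) with _ | ⟨b, q⟩
    · rw [explore_succ_of_none h] at ha ⊢
      rw [stepPerm, h]
      exact ih ha
    · obtain ⟨hb, -, hq, -⟩ := moveAt_eq_some h
      by_cases hab : a = b
      · subst hab
        refine ⟨q, ?_, ?_⟩
        · rw [explore_succ_of_some h]; simp
        · rw [stepPerm, Equiv.Perm.mul_apply, h, stepSwap, Equiv.swap_apply_right,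
            (stepPerm_fresh n).1 a hb.ge]
      · obtain ⟨p, hp, hpa⟩ := ih (by
          rw [explore_succ_of_some h] at ha
          by_cases h1 : a.1 = b.1
          · have : a.2 ≠ b.2 := fun h2 => hab (Prod.ext h1 h2)
            simp only [h1, Function.update_self] at ha ⊢
            omega
          · simpa [h1] using ha)
        refine ⟨p, hp.trans_le (explore_steps_le_succ n _), ?_⟩
        have hpq : p ≠ q := by rintro rfl; omega
        rw [stepPerm, Equiv.Perm.mul_apply, h, stepSwap,
          Equiv.swap_apply_of_ne_of_ne (by simp) (by simpa using hpq), hpa]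

theorem stepPerm_of_done {n : ℕ} (hn : (explore s F n).1 = N) :
    ∀ m, n ≤ m → stepPerm s F m = stepPerm s F n := by
  intro m hm
  induction m, hm using Nat.le_induction with
  | base => rfl
  | succ m hm ih =>
    rw [stepPerm, ih, moveAt_of_le (by rw [explore_of_done hn m hm, hn]), stepSwap, mul_one]

/-- A move made before time `n` is recorded by the permutation at time `n`. -/
theorem stepPerm_of_move {m n : ℕ} (hmn : m < n) {a p : Fin N × ℕ}
    (h : moveAt s F (explore s F m) = some (a, p)) : stepPerm s F n (Sum.inr p) = Sum.inl a := by
  induction n, (hmn : m + 1 ≤ n) using Nat.le_induction with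
  | base =>
    rw [stepPerm, Equiv.Perm.mul_apply, h, stepSwap, Equiv.swap_apply_right,
      (stepPerm_fresh m).1 a (moveAt_eq_some h).1.ge]
  | succ n hn ih =>
    have hp : p.2 < (explore s F n).2.2 p.1 := by
      refine lt_of_lt_of_le ?_ (explore_mono_steps hn p.1)
      simp only [explore_succ_of_some h, Function.update_self]
      omega
    rw [stepPerm, Equiv.Perm.mul_apply]
    rcases h' : moveAt s F (explore s F n) with _ | ⟨b, q⟩
    · exact ih
    · have hpq : p ≠ q := by
        rintro rfl
        have := (moveAt_eq_some h').2.2.1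
        omega
      rw [stepSwap, Equiv.swap_apply_of_ne_of_ne (by simp) (by simpa using hpq)]
      exact ih

/-- When the exploration has terminated, the internal DLA explorers have made exactly the explored
steps of the trajectories. -/
theorem sameSteps_of_done {w : Fin N → ℕ → V d} (hM : Matches s F w) (hs0 : ∀ i, s i 0 = 0)
    (hw0 : ∀ i, w i 0 = 0) {n : ℕ} (hn : (explore s F n).1 = N) :
    SameSteps w (idlaTime w) s (explore s F n).2.1 := by
  have hτ : ∀ i, idlaTime w i = (explore s F n).2.2 i := fun i =>
    (hM.inv hs0 hw0 n).settled i (by rw [hn]; exact i.2)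
  have hlt : ∀ p : Fin N × ℕ, (p.2 : ℕ∞) < idlaTime w p.1 ↔ p.2 < (explore s F n).2.2 p.1 := by
    intro p; rw [hτ]; exact Nat.cast_lt
  refine ⟨fun p => Sum.elim id id (stepPerm s F n (Sum.inr p)), ⟨?_, ?_, ?_⟩, ?_⟩
  · intro p hp
    obtain ⟨a, -, h1, h2⟩ := stepPerm_inr n p ((hlt p).1 hp)
    simpa [h1] using h2
  · intro p hp q hq hpq
    obtain ⟨a, -, h1, -⟩ := stepPerm_inr n p ((hlt p).1 hp)
    obtain ⟨b, -, h2, -⟩ := stepPerm_inr n q ((hlt q).1 hq)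
    simp only [h1, h2, Sum.elim_inl, id] at hpq
    subst hpq
    exact Sum.inr_injective ((stepPerm s F n).injective (h1.trans h2.symm))
  · intro a ha
    obtain ⟨p, hp, h1⟩ := stepPerm_inl n a ha
    exact ⟨p, (hlt p).2 hp, by simp [h1]⟩
  · intro p hp
    obtain ⟨a, ⟨m, -, hm⟩, h1, -⟩ := stepPerm_inr n p ((hlt p).1 hp)
    have := ((hM.inv hs0 hw0 m).step_some hm (hM m a p hm)).2
    simpa [h1] using this

end Exploration

/-! ### Measurability -/

section Measurability

variable {d N : ℕ} {Ω : Type*} [MeasurableSpace Ω]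

theorem measurable_firstTime {Q : Ω → ℕ → Prop} (hQ : ∀ t, MeasurableSet {ω | Q ω t}) :
    Measurable fun ω => firstTime (Q ω) := by
  have hcoe : ∀ t : ℕ, MeasurableSet ((fun ω => firstTime (Q ω)) ⁻¹' {(t : ℕ∞)}) := by
    intro t
    have : (fun ω => firstTime (Q ω)) ⁻¹' {(t : ℕ∞)} =
        {ω | Q ω t} ∩ ⋂ u, ⋂ (_ : u < t), {ω | Q ω u}ᶜ := by
      ext ω
      simp [firstTime_eq_coe_iff]
    rw [this]
    exact (hQ t).inter (MeasurableSet.iInter fun u => MeasurableSet.iInter fun _ => (hQ u).compl)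
  refine measurable_to_countable' fun x => ?_
  induction x using ENat.recTopCoe with
  | coe t => exact hcoe t
  | top =>
    have : (fun ω => firstTime (Q ω)) ⁻¹' {⊤} = ⋂ t, {ω | Q ω t}ᶜ := by
      ext ω
      have := (firstTime_ne_top_iff (Q := Q ω)).not
      push Not at this
      simpa using this
    rw [this]
    exact MeasurableSet.iInter fun t => (hQ t).compl

variable {s : Ω → Fin N → ℕ → V d} {F : Ω → Fin N → Set ℕ}

theorem measurable_eval_of_countable {ι β : Type*} [Countable ι] [MeasurableSpace ι]
    [MeasurableSingletonClass ι] [MeasurableSpace β] {f : ι → Ω → β} (hf : ∀ i, Measurable (f i))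
    {g : Ω → ι} (hg : Measurable g) : Measurable fun ω => f (g ω) ω :=
  (measurable_from_prod_countable_right (f := fun q : ι × Ω => f q.1 q.2) hf).comp
    (hg.prodMk measurable_id)

theorem measurableSet_notMem_of_forall (hs : ∀ i t, Measurable fun ω => s ω i t)
    (hF : ∀ i t, MeasurableSet {ω | t ∈ F ω i}) {A : Ω → Set (V d)}
    (hA : ∀ x, MeasurableSet {ω | x ∈ A ω}) (i : Fin N) (t : ℕ) :
    MeasurableSet {ω | t ∈ F ω i ∧ s ω i t ∉ A ω} := by
  have : {ω | t ∈ F ω i ∧ s ω i t ∉ A ω} =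
      {ω | t ∈ F ω i} ∩ ⋃ y, {ω | s ω i t = y} ∩ {ω | y ∈ A ω}ᶜ := by
    ext ω; simp
  rw [this]
  exact (hF i t).inter (MeasurableSet.iUnion fun y =>
    ((hs i t) (measurableSet_singleton y)).inter (hA y).compl)

theorem measurableSet_mem_cluster (hs : ∀ i t, Measurable fun ω => s ω i t)
    (hF : ∀ i t, MeasurableSet {ω | t ∈ F ω i}) (k : ℕ) (x : V d) :
    MeasurableSet {ω | x ∈ cluster (s ω) (F ω) k} := by
  induction k generalizing x with
  | zero => exact MeasurableSet.empty
  | succ k ih =>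
    have : {ω | x ∈ cluster (s ω) (F ω) (k + 1)} = {ω | x ∈ cluster (s ω) (F ω) k} ∪
        ⋃ (hk : k < N), ⋃ t : ℕ, {ω | settleTime (s ω ⟨k, hk⟩) (F ω ⟨k, hk⟩)
          (cluster (s ω) (F ω) k) = (t : ℕ∞)} ∩ {ω | s ω ⟨k, hk⟩ t = x} := by
      ext ω; simp [cluster]
    rw [this]
    refine (ih x).union (MeasurableSet.iUnion fun hk => MeasurableSet.iUnion fun t => ?_)
    exact (measurable_firstTime (measurableSet_notMem_of_forall hs hF ih ⟨k, hk⟩)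
      (measurableSet_singleton _)).inter (hs _ t (measurableSet_singleton x))

theorem measurable_settlingTime (hs : ∀ i t, Measurable fun ω => s ω i t)
    (hF : ∀ i t, MeasurableSet {ω | t ∈ F ω i}) (i : Fin N) :
    Measurable fun ω => settlingTime (s ω) (F ω) i :=
  measurable_firstTime (measurableSet_notMem_of_forall hs hF (measurableSet_mem_cluster hs hF i) i)

theorem measurableSet_moveAt_eq (hs : ∀ i t, Measurable fun ω => s ω i t)
    (hF : ∀ i t, MeasurableSet {ω | t ∈ F ω i}) (st : State N)
    (x : Option ((Fin N × ℕ) × (Fin N × ℕ))) :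
    MeasurableSet {ω | moveAt (s ω) (F ω) st = x} := by
  classical
  have h : Measurable fun ω => ((fun i => s ω i (st.2.1 i), fun i => decide (st.2.1 i ∈ F ω i)) :
      (Fin N → V d) × (Fin N → Bool)) := by
    refine (measurable_pi_lambda _ fun i => hs i _).prodMk (measurable_pi_lambda _ fun i => ?_)
    refine measurable_to_bool ?_
    have : (fun ω => decide (st.2.1 i ∈ F ω i)) ⁻¹' {true} = {ω | st.2.1 i ∈ F ω i} := by
      ext ω; simp
    rw [this]
    exact hF i _
  have e : {ω | moveAt (s ω) (F ω) st = x} =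
      (fun ω => ((fun i => s ω i (st.2.1 i), fun i => decide (st.2.1 i ∈ F ω i)) :
      (Fin N → V d) × (Fin N → Bool))) ⁻¹' {q | nextMove st q.1 q.2 = x} := by
    ext ω
    simp only [Set.mem_ofPred_eq, Set.mem_preimage, moveAt]
  rw [e]
  exact h (MeasurableSet.of_discrete)

theorem measurable_explore (hs : ∀ i t, Measurable fun ω => s ω i t)
    (hF : ∀ i t, MeasurableSet {ω | t ∈ F ω i}) (n : ℕ) :
    Measurable fun ω => explore (s ω) (F ω) n := by
  induction n with
  | zero => exact measurable_const
  | succ n ih =>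
    refine measurable_eval_of_countable (f := fun st ω => st.apply (moveAt (s ω) (F ω) st))
      (fun st => ?_) ih
    refine measurable_to_countable' fun σ => ?_
    have : (fun ω => st.apply (moveAt (s ω) (F ω) st)) ⁻¹' {σ} =
        ⋃ x, ⋃ (_ : st.apply x = σ), {ω | moveAt (s ω) (F ω) st = x} := by
      ext ω; simp
    rw [this]
    exact MeasurableSet.iUnion fun x => MeasurableSet.iUnion fun _ =>
      measurableSet_moveAt_eq hs hF st x

theorem measurableSet_moveAt_explore_eq (hs : ∀ i t, Measurable fun ω => s ω i t)
    (hF : ∀ i t, MeasurableSet {ω | t ∈ F ω i}) (n : ℕ)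
    (x : Option ((Fin N × ℕ) × (Fin N × ℕ))) :
    MeasurableSet {ω | moveAt (s ω) (F ω) (explore (s ω) (F ω) n) = x} := by
  have : {ω | moveAt (s ω) (F ω) (explore (s ω) (F ω) n) = x} =
      ⋃ st, {ω | explore (s ω) (F ω) n = st} ∩ {ω | moveAt (s ω) (F ω) st = x} := by
    ext ω; simp
  rw [this]
  exact MeasurableSet.iUnion fun st =>
    (measurable_explore hs hF n (measurableSet_singleton st)).inter
      (measurableSet_moveAt_eq hs hF st x)

/-- The number of steps after which the exploration has terminated (zero if it never does). -/
def explorationTime (s : Fin N → ℕ → V d) (F : Fin N → Set ℕ) : ℕ :=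
  (firstTime fun n => (explore s F n).1 = N).toNat

theorem explore_explorationTime {s : Fin N → ℕ → V d} {F : Fin N → Set ℕ}
    (h : ∀ i, settlingTime s F i ≠ ⊤) : (explore s F (explorationTime s F)).1 = N := by
  obtain ⟨n, hn⟩ := ENat.ne_top_iff_exists.1 (firstTime_ne_top_iff.2 (exists_explore_done h))
  rw [explorationTime, ← hn, ENat.toNat_natCast]
  exact (firstTime_eq_coe_iff.1 hn.symm).1

theorem measurable_explorationTime (hs : ∀ i t, Measurable fun ω => s ω i t)
    (hF : ∀ i t, MeasurableSet {ω | t ∈ F ω i}) :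
    Measurable fun ω => explorationTime (s ω) (F ω) :=
  (Measurable.of_discrete (f := ENat.toNat)).comp (measurable_firstTime fun n =>
    (measurable_fst.comp (measurable_explore hs hF n)) (measurableSet_singleton N))

end Measurability

/-! ### Adapted exchanges preserve the measure -/

/-- If the choice of a measure preserving map is not affected by the chosen map, then applying the
chosen map preserves the measure. -/
theorem measurePreserving_of_invariant_choice {α C : Type*} [MeasurableSpace α] [Countable C]
    {P : Measure α} {f : C → α → α} (hf : ∀ c, MeasurePreserving (f c) P P) {c : α → C}
    (hc : ∀ x, MeasurableSet {a | c a = x}) (hinv : ∀ x a, c (f x a) = x ↔ c a = x) :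
    MeasurePreserving (fun a => f (c a) a) P P := by
  have hpre : ∀ B : Set α, (fun a => f (c a) a) ⁻¹' B = ⋃ x, f x ⁻¹' ({a | c a = x} ∩ B) := by
    intro B
    ext a
    simp [hinv]
  have hB : ∀ B : Set α, B = ⋃ x, {a | c a = x} ∩ B := by intro B; ext a; simp
  have hm : Measurable fun a => f (c a) a := by
    intro B hBm
    rw [hpre]
    exact MeasurableSet.iUnion fun x => (hf x).measurable ((hc x).inter hBm)
  refine ⟨hm, Measure.ext fun B hBm => ?_⟩
  rw [Measure.map_apply hm hBm, hpre, measure_iUnion, hB B, measure_iUnion]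
  · rw [← hB B]
    exact tsum_congr fun x =>
      (hf x).measure_preimage ((hc x).inter hBm).nullMeasurableSet
  · intro x y hxy
    exact Set.disjoint_left.2 fun a ha hb => hxy (ha.1.symm.trans hb.1)
  · exact fun x => (hc x).inter hBm
  · intro x y hxy
    refine Set.disjoint_left.2 fun a ha hb => hxy ?_
    exact ((hinv x a).1 ha.1).symm.trans ((hinv y a).1 hb.1)
  · exact fun x => (hf x).measurable ((hc x).inter hBm)

/-- A map that agrees almost surely with the terms of large index of a sequence of measure
preserving maps is measure preserving. -/
theorem measurePreserving_of_eventually_eq {α : Type*} [MeasurableSpace α] {P : Measure α}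
    [IsFiniteMeasure P] {f : ℕ → α → α} (hf : ∀ n, MeasurePreserving (f n) P P) {g : α → α}
    (hg : Measurable g) (h : ∀ᵐ a ∂P, ∀ᶠ n in Filter.atTop, f n a = g a) :
    MeasurePreserving g P P := by
  refine ⟨hg, Measure.ext fun B hB => ?_⟩
  rw [Measure.map_apply hg hB]
  have hlim : Filter.Tendsto (fun n => P (f n ⁻¹' B)) Filter.atTop (nhds (P (g ⁻¹' B))) := by
    refine tendsto_measure_of_ae_tendsto_indicator_of_isFiniteMeasure Filter.atTop (hg hB)
      (fun n => (hf n).measurable hB) ?_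
    filter_upwards [h] with a ha
    filter_upwards [ha] with n hn
    rw [Set.mem_preimage, Set.mem_preimage, hn]
  refine tendsto_nhds_unique hlim ?_
  simp only [(hf _).measure_preimage hB.nullMeasurableSet]
  exact tendsto_const_nhds

/-! ### The law of the internal DLA trajectories -/

/-- The indices of the steps: those of the trajectories on the left, those reserved for the internal
DLA explorers on the right. -/
abbrev StepIndex (N : ℕ) : Type := (Fin N × ℕ) ⊕ (Fin N × ℕ)

/-- The trajectories started at the origin with the increments `x (i, u)`. -/
def walk {d N : ℕ} (x : Fin N × ℕ → V d) (i : Fin N) (t : ℕ) : V d :=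
  ∑ u ∈ Finset.range t, x (i, u)

theorem walk_zero {d N : ℕ} (x : Fin N × ℕ → V d) (i : Fin N) : walk x i 0 = 0 := by simp [walk]

theorem walk_succ_sub {d N : ℕ} (x : Fin N × ℕ → V d) (i : Fin N) (t : ℕ) :
    walk x i (t + 1) - walk x i t = x (i, t) := by
  simp [walk, Finset.sum_range_succ]

theorem walk_congr {d N : ℕ} {x y : Fin N × ℕ → V d} {i : Fin N} {t : ℕ}
    (h : ∀ u < t, x (i, u) = y (i, u)) : walk x i t = walk y i t :=
  Finset.sum_congr rfl fun u hu => h u (Finset.mem_range.1 hu)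

section Law

variable {d N : ℕ} {M : Type*}

/-- The trajectories of the `N` explorers of the cluster growth with allowed times. -/
def leftWalk (x : StepIndex N → V d) : Fin N → ℕ → V d := walk fun a => x (Sum.inl a)

theorem measurable_leftWalk (i : Fin N) (t : ℕ) :
    Measurable fun x : StepIndex N → V d => leftWalk x i t := by
  unfold leftWalk walk
  fun_prop

/-- A rule giving the allowed times from the trajectories and from additional randomness `m : M`
is adapted if whether `t` is an allowed time depends only on the trajectory up to time `t`. -/
def Adapted (A : (Fin N → ℕ → V d) → M → Fin N → Set ℕ) : Prop :=
  ∀ s s' m i t, (∀ u ≤ t, s i u = s' i u) → (t ∈ A s m i ↔ t ∈ A s' m i)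

variable (A : (Fin N → ℕ → V d) → M → Fin N → Set ℕ)

/-- The allowed times as functions of the randomness. -/
def times (ω : (StepIndex N → V d) × M) : Fin N → Set ℕ := A (leftWalk ω.1) ω.2

/-- The move made by the exploration at step `n`. -/
def randMove (n : ℕ) (ω : (StepIndex N → V d) × M) : Option ((Fin N × ℕ) × (Fin N × ℕ)) :=
  moveAt (leftWalk ω.1) (times A ω) (explore (leftWalk ω.1) (times A ω) n)

/-- The randomness with its increments permuted by `σ`, the additional randomness unchanged. -/
def permute (σ : Equiv.Perm (StepIndex N)) (ω : (StepIndex N → V d) × M) :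
    (StepIndex N → V d) × M := (fun i => ω.1 (σ i), ω.2)

/-- The randomness with its increments permuted by the first `n` steps of the exploration: an
increment reserved for an internal DLA explorer has been exchanged with the increment read. -/
def rearrange (n : ℕ) (ω : (StepIndex N → V d) × M) : (StepIndex N → V d) × M :=
  permute (stepPerm (leftWalk ω.1) (times A ω) n) ω

theorem measurePreserving_permute [MeasurableSpace M] {μ : Measure (V d)}
    [IsProbabilityMeasure μ] {ν : Measure M} [IsProbabilityMeasure ν]
    (σ : Equiv.Perm (StepIndex N)) :
    MeasurePreserving (permute (M := M) σ)
      ((Measure.infinitePi fun _ : StepIndex N => μ).prod ν)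
      ((Measure.infinitePi fun _ : StepIndex N => μ).prod ν) := by
  refine MeasurePreserving.prod (f := fun (x : StepIndex N → V d) i => x (σ i)) (g := id) ⟨?_, ?_⟩
    (MeasurePreserving.id ν)
  · fun_prop
  · exact Measure.map_infinitePi_infinitePi_of_inj (P := fun _ : StepIndex N => μ) σ.injective

variable {A}

/-- Exchanging the fresh increments used at step `n` changes nothing to the exploration up to this
step. -/
theorem explore_permute_stepSwap (hA : Adapted A) {n : ℕ} {ω : (StepIndex N → V d) × M}
    {x : Option ((Fin N × ℕ) × (Fin N × ℕ))} (hx : randMove A n ω = x) {m : ℕ} (hm : m ≤ n) :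
    explore (leftWalk (permute (stepSwap x) ω).1) (times A (permute (stepSwap x) ω)) m =
      explore (leftWalk ω.1) (times A ω) m ∧
    randMove A m (permute (stepSwap x) ω) = randMove A m ω := by
  have hs : ∀ i, ∀ u ≤ (explore (leftWalk ω.1) (times A ω) n).2.1 i,
      leftWalk ω.1 i u = leftWalk (permute (stepSwap x) ω).1 i u := by
    intro i u hu
    refine walk_congr fun v hv => ?_
    rcases x with _ | ⟨a, p⟩
    · rfl
    · have ha := (moveAt_eq_some hx).1
      have hne : (i, v) ≠ a := by rintro rfl; simp only at ha; omega
      simp only [permute, stepSwap]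
      rw [Equiv.swap_apply_of_ne_of_ne (by simpa using hne) (by simp)]
  have hF : ∀ i, ∀ u ≤ (explore (leftWalk ω.1) (times A ω) n).2.1 i,
      u ∈ times A ω i ↔ u ∈ times A (permute (stepSwap x) ω) i := fun i u hu =>
    hA _ _ _ _ _ fun v hv => hs i v (hv.trans hu)
  have he := explore_congr hs hF m hm
  refine ⟨he, ?_⟩
  rw [randMove, he, randMove]
  exact (moveAt_congr (fun i => hs i _ (explore_mono_time hm i))
    (fun i => hF i _ (explore_mono_time hm i))).symm

theorem stepPerm_permute_stepSwap (hA : Adapted A) {n : ℕ} {ω : (StepIndex N → V d) × M}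
    {x : Option ((Fin N × ℕ) × (Fin N × ℕ))} (hx : randMove A n ω = x) {m : ℕ} (hm : m ≤ n) :
    stepPerm (leftWalk (permute (stepSwap x) ω).1) (times A (permute (stepSwap x) ω)) m =
      stepPerm (leftWalk ω.1) (times A ω) m := by
  induction m with
  | zero => rfl
  | succ m ih =>
    have := (explore_permute_stepSwap hA hx (by omega : m ≤ n)).2
    unfold randMove at this
    rw [stepPerm, ih (by omega), this, stepPerm]

/-- The increments exchanged at step `n` being fresh, they may as well be exchanged first. -/
theorem rearrange_succ (hA : Adapted A) (n : ℕ) (ω : (StepIndex N → V d) × M) :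
    rearrange A (n + 1) ω = rearrange A n (permute (stepSwap (randMove A n ω)) ω) := by
  unfold rearrange
  rw [stepPerm_permute_stepSwap hA rfl le_rfl, stepPerm]
  change permute (_ * stepSwap (randMove A n ω)) ω = _
  -- The earlier exchanges fix the two increments exchanged at step `n`, as they are fresh.
  have hcomm : stepPerm (leftWalk ω.1) (times A ω) n * stepSwap (randMove A n ω) =
      stepSwap (randMove A n ω) * stepPerm (leftWalk ω.1) (times A ω) n := by
    rcases h : randMove A n ω with _ | ⟨a, p⟩
    · rfl
    · obtain ⟨ha, -, hp, -⟩ := moveAt_eq_some h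
      have hf := stepPerm_fresh (s := leftWalk ω.1) (F := times A ω) n
      rw [stepSwap, Equiv.mul_swap_eq_swap_mul, hf.1 a ha.ge, hf.2 p hp.ge]
  rw [hcomm]
  rfl

/-- The rearrangement after `n` steps preserves the law of the randomness. -/
theorem measurePreserving_rearrange [MeasurableSpace M] (hA : Adapted A)
    (hAm : ∀ i t, MeasurableSet {ω : (StepIndex N → V d) × M | t ∈ times A ω i})
    {μ : Measure (V d)} [IsProbabilityMeasure μ] {ν : Measure M} [IsProbabilityMeasure ν] (n : ℕ) :
    MeasurePreserving (rearrange A n) ((Measure.infinitePi fun _ : StepIndex N => μ).prod ν)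
      ((Measure.infinitePi fun _ : StepIndex N => μ).prod ν) := by
  induction n with
  | zero => exact MeasurePreserving.id _
  | succ n ih =>
    rw [funext (rearrange_succ hA n)]
    refine ih.comp (measurePreserving_of_invariant_choice (c := randMove A n)
      (f := fun x => permute (stepSwap x)) (fun x => measurePreserving_permute _) ?_ ?_)
    · exact measurableSet_moveAt_explore_eq
        (fun i t => (measurable_leftWalk i t).comp measurable_fst) hAm n
    · intro x ω
      constructor
      · intro h
        -- The exchange is an involution, so this is the converse implication at the image of `ω`.
        have h2 := (explore_permute_stepSwap hA h le_rfl).2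
        have hinv : permute (stepSwap x) (permute (stepSwap x) ω) = ω := by
          refine Prod.ext (funext fun i => ?_) rfl
          simp only [permute]
          rcases x with _ | c
          · rfl
          · simp [stepSwap]
        rw [hinv] at h2
        exact h2.trans h
      · intro h
        exact (explore_permute_stepSwap hA h le_rfl).2.trans h

variable (A) in
/-- The rearrangement of the increments at the end of the exploration. -/
def finalRearrange (ω : (StepIndex N → V d) × M) : (StepIndex N → V d) × M :=
  rearrange A (explorationTime (leftWalk ω.1) (times A ω)) ω

theorem measurePreserving_finalRearrange [MeasurableSpace M] (hA : Adapted A)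
    (hAm : ∀ i t, MeasurableSet {ω : (StepIndex N → V d) × M | t ∈ times A ω i})
    {μ : Measure (V d)} [IsProbabilityMeasure μ] {ν : Measure M} [IsProbabilityMeasure ν]
    (hfin : ∀ᵐ ω ∂(Measure.infinitePi fun _ : StepIndex N => μ).prod ν,
      ∀ i, settlingTime (leftWalk ω.1) (times A ω) i ≠ ⊤) :
    MeasurePreserving (finalRearrange A) ((Measure.infinitePi fun _ : StepIndex N => μ).prod ν)
      ((Measure.infinitePi fun _ : StepIndex N => μ).prod ν) := by
  refine measurePreserving_of_eventually_eq (measurePreserving_rearrange hA hAm) ?_ ?_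
  · exact measurable_eval_of_countable
      (fun n => (measurePreserving_rearrange hA hAm (μ := μ) (ν := ν) n).measurable)
      (measurable_explorationTime (fun i t => (measurable_leftWalk i t).comp measurable_fst) hAm)
  · filter_upwards [hfin] with ω hω
    filter_upwards [Filter.eventually_ge_atTop
      (explorationTime (leftWalk ω.1) (times A ω))] with n hn
    simp only [finalRearrange, rearrange]
    rw [stepPerm_of_done (explore_explorationTime hω) n hn]

/-- The trajectories with the increments reserved for the internal DLA explorers. They are the
internal DLA trajectories when read off from the rearranged increments. -/
def rightWalk (x : StepIndex N → V d) : Fin N → ℕ → V d := walk fun p => x (Sum.inr p)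

/-- The internal DLA trajectories read off from the rearranged increments match the exploration. -/
theorem matches_finalRearrange {ω : (StepIndex N → V d) × M}
    (hω : ∀ i, settlingTime (leftWalk ω.1) (times A ω) i ≠ ⊤) :
    Matches (leftWalk ω.1) (times A ω) (rightWalk (finalRearrange A ω).1) := by
  intro n a p h
  have hn : n < explorationTime (leftWalk ω.1) (times A ω) := by
    by_contra! hle
    have hd := explore_explorationTime hω
    rw [moveAt_of_le (by rw [explore_of_done hd n hle, hd])] at h
    cases h
  rw [rightWalk, leftWalk, walk_succ_sub, walk_succ_sub]
  simp only [finalRearrange, rearrange, permute]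
  rw [stepPerm_of_move hn h]

end Law

/-! ### The geometry of the lattice -/

section Lattice

variable {d : ℕ}

theorem emb_sub (x y : V d) : emb (x - y) = emb x - emb y := by
  ext i
  simp [emb]

theorem emb_zero : emb (0 : V d) = 0 := by
  ext i
  simp [emb]

theorem nbr_sub_zero_iff {x y : V d} : Nbr (x - y) 0 ↔ Nbr x y := by
  simp only [Nbr, emb_sub, emb_zero, sub_zero]

theorem finite_nbr (d : ℕ) : {e : V d | Nbr e 0}.Finite := by
  refine (Set.finite_Icc (-1 : V d) 1).subset fun e he => ?_
  have h1 : ‖emb e‖ = 1 := by simpa [Nbr, emb_zero] using he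
  have h2 : ∀ i, |e i| ≤ 1 := by
    intro i
    have := PiLp.norm_apply_le (emb e) i
    rw [h1] at this
    simp only [emb, Real.norm_eq_abs] at this
    exact_mod_cast this
  exact ⟨fun i => (abs_le.1 (h2 i)).1, fun i => (abs_le.1 (h2 i)).2⟩

theorem nonempty_nbr (hd : 0 < d) : {e : V d | Nbr e 0}.Nonempty := by
  refine ⟨Pi.single ⟨0, hd⟩ 1, ?_⟩
  have : emb (Pi.single ⟨0, hd⟩ 1 : V d) = EuclideanSpace.single ⟨0, hd⟩ 1 := by
    ext i
    by_cases h : i = ⟨0, hd⟩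
    · subst h; simp [emb]
    · simp [emb, h]
  simp [Nbr, emb_zero, this]

theorem isProbabilityMeasure_uniformOn_nbr (hd : 0 < d) :
    IsProbabilityMeasure (uniformOn {e : V d | Nbr e 0}) :=
  isProbabilityMeasure_uniformOn (finite_nbr d) (nonempty_nbr hd)

end Lattice

/-! ### Infinitely many independent chances -/

theorem ae_frequently_mem_of_iIndepSet {Ω : Type*} [MeasurableSpace Ω] {P : Measure Ω}
    {A : ℕ → Set Ω} (hA : ∀ n, MeasurableSet (A n)) (hI : iIndepSet A P) {c : ENNReal} (hc : c ≠ 0)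
    (h : ∀ n, c ≤ P (A n)) : ∀ᵐ ω ∂P, ∃ᶠ n in Filter.atTop, ω ∈ A n := by
  have := hI.isProbabilityMeasure
  have hsum : ∑' n, P (A n) = ⊤ := by
    refine top_le_iff.1 ?_
    rw [← ENNReal.tsum_const_eq_top_of_ne_zero (α := ℕ) hc]
    exact ENNReal.tsum_le_tsum h
  have h1 := measure_limsup_eq_one hA hI hsum
  have h2 : ∀ᵐ ω ∂P, ω ∈ Filter.limsup A Filter.atTop :=
    (mem_ae_iff_prob_eq_one (MeasurableSet.measurableSet_limsup hA)).2 h1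
  filter_upwards [h2] with ω hω
  exact Filter.mem_limsup_iff_frequently_mem.1 hω

theorem iIndepSet_preimage_of_iIndepFun {Ω ι β : Type*} [MeasurableSpace Ω] [MeasurableSpace β]
    {P : Measure Ω} {f : ι → Ω → β} (hf : iIndepFun f P) (hm : ∀ i, Measurable (f i))
    {B : ι → Set β} (hB : ∀ i, MeasurableSet (B i)) : iIndepSet (fun i => f i ⁻¹' B i) P := by
  rw [iIndepSet_iff_meas_biInter fun i => hm i (hB i)]
  intro S
  exact hf.measure_inter_preimage_eq_mul S fun i _ => hB i

/-! ### Simple random walk is unbounded -/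

section Walk

variable {d N : ℕ} {Ω : Type*} [MeasurableSpace Ω] {P : Measure Ω} {S : Fin N → ℕ → Ω → V d}

theorem IsWalkFamily.measurable_step (hS : IsWalkFamily P S) (i : Fin N) (t : ℕ) :
    Measurable fun ω => S i (t + 1) ω - S i t ω :=
  (hS.measurable i (t + 1)).sub (hS.measurable i t)

theorem IsWalkFamily.measure_step (hS : IsWalkFamily P S) (i : Fin N) (t : ℕ) (B : Set (V d)) :
    P {ω | S i (t + 1) ω - S i t ω ∈ B} = uniformOn {e : V d | Nbr e 0} B := by
  rw [← hS.law i t, Measure.map_apply (hS.measurable_step i t) (MeasurableSet.of_discrete)]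
  rfl

theorem IsWalkFamily.ae_nbr (hS : IsWalkFamily P S) :
    ∀ᵐ ω ∂P, ∀ i t, Nbr (S i (t + 1) ω) (S i t ω) := by
  rw [ae_all_iff]
  intro i
  rw [ae_all_iff]
  intro t
  have h : P {ω | S i (t + 1) ω - S i t ω ∈ {e : V d | Nbr e 0}ᶜ} = 0 := by
    rw [hS.measure_step, uniformOn_eq_zero_iff (finite_nbr d), Set.inter_compl_self]
  rw [ae_iff]
  refine le_antisymm (le_trans (measure_mono ?_) h.le) bot_le
  intro ω hω
  simpa [nbr_sub_zero_iff] using hω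

/-- Almost surely there are arbitrarily long runs of steps equal to a given neighbour of the
origin. -/
theorem IsWalkFamily.ae_exists_run (hS : IsWalkFamily P S) {e : V d} (he : Nbr e 0)
    (i : Fin N) (L : ℕ) :
    ∀ᵐ ω ∂P, ∃ t, ∀ v < L, S i (t + v + 1) ω - S i (t + v) ω = e := by
  rcases Nat.eq_zero_or_pos L with rfl | hL
  · simp
  -- Blocks of `L` consecutive steps are independent, and each is a run with probability `p ^ L`.
  let f : ℕ × Fin L → Ω → V d := fun q ω =>
    S i (q.1 * L + q.2 + 1) ω - S i (q.1 * L + q.2) ω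
  have hinj : Function.Injective fun q : ℕ × Fin L => (i, q.1 * L + (q.2 : ℕ)) := by
    rintro ⟨m, v⟩ ⟨m', v'⟩ h
    simp only [Prod.mk.injEq, true_and] at h
    have hm : m = m' := by
      have := congrArg (· / L) h
      simpa [Nat.add_comm, Nat.add_mul_div_right _ _ hL, Nat.div_eq_of_lt] using this
    subst hm
    have : v = v' := Fin.ext (by omega)
    rw [this]
  have hf : iIndepFun f P := iIndepFun.precomp hinj hS.indep
  have hfm : ∀ q, Measurable (f q) := fun q => hS.measurable_step i _
  let p := uniformOn {e : V d | Nbr e 0} {e}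
  have hp : ∀ q, P (f q ⁻¹' {e}) = p := fun q => hS.measure_step i _ {e}
  have hp0 : p ≠ 0 := by
    rw [Ne, uniformOn_eq_zero_iff (finite_nbr d)]
    exact (Set.Nonempty.ne_empty ⟨e, he, rfl⟩)
  let A : ℕ → Set Ω := fun m => ⋂ v : Fin L, f (m, v) ⁻¹' {e}
  have hAm : ∀ m, MeasurableSet (A m) := fun m =>
    MeasurableSet.iInter fun v => hfm _ (measurableSet_singleton e)
  have hprod : ∀ s : Finset ℕ, P (⋂ m ∈ s, A m) = ∏ m ∈ s, ∏ _v : Fin L, p := by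
    intro s
    have h1 := hf.measure_inter_preimage_eq_mul (s ×ˢ Finset.univ) (sets := fun _ => {e})
      (fun _ _ => measurableSet_singleton e)
    simp only [hp, Finset.prod_product] at h1
    rw [← h1]
    congr 1
    ext ω
    simp only [A, Set.mem_iInter, Finset.mem_product, Finset.mem_univ, and_true, Prod.forall]
    exact ⟨fun h m v hm => h m hm v, fun h m hm v => h m v hm⟩
  have hA1 : ∀ m, P (A m) = p ^ L := by
    intro m
    simpa using hprod {m}
  have hI : iIndepSet A P := by
    rw [iIndepSet_iff_meas_biInter hAm]
    intro s
    rw [hprod]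
    exact Finset.prod_congr rfl fun m _ => by simp [hA1]
  filter_upwards [ae_frequently_mem_of_iIndepSet hAm hI (pow_ne_zero L hp0)
    fun m => (hA1 m).ge] with ω hω
  obtain ⟨m, hm⟩ := hω.exists
  exact ⟨m * L, fun v hv => Set.mem_iInter.1 hm ⟨v, hv⟩⟩

/-- A walk with a run of `L` equal unit steps covers the distance `L`. -/
theorem IsWalkFamily.ae_unbounded (hd : 0 < d) (hS : IsWalkFamily P S) :
    ∀ᵐ ω ∂P, ∀ i, ∀ r : ℝ, ∃ t, r ≤ ‖emb (S i t ω)‖ := by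
  obtain ⟨e, he⟩ := nonempty_nbr hd
  have hall : ∀ᵐ ω ∂P, ∀ i, ∀ L : ℕ, ∃ t, ∀ v < L, S i (t + v + 1) ω - S i (t + v) ω = e :=
    ae_all_iff.2 fun i => ae_all_iff.2 fun L => hS.ae_exists_run he i L
  filter_upwards [hall] with ω hω i r
  by_contra! hlt
  obtain ⟨L, hL⟩ := exists_nat_gt (2 * r)
  obtain ⟨t, ht⟩ := hω i L
  have key : ∀ v ≤ L, emb (S i (t + v) ω) - emb (S i t ω) = (v : ℝ) • emb e := by
    intro v
    induction v with
    | zero => intro _; simp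
    | succ v ih =>
      intro hv
      have h1 := congrArg emb (ht v (by omega))
      rw [emb_sub] at h1
      rw [← add_assoc, Nat.cast_add, Nat.cast_one, add_smul, one_smul, ← ih (by omega), ← h1]
      abel
  have h1 := congrArg norm (key L le_rfl)
  have he1 : ‖emb e‖ = 1 := by simpa [Nbr, emb_zero] using he
  rw [norm_smul, he1, mul_one, Real.norm_natCast] at h1
  have h2 := norm_sub_le (emb (S i (t + L) ω)) (emb (S i t ω))
  have h3 := hlt t
  have h4 := hlt (t + L)
  linarith

end Walk

/-! ### Flashing times -/

section Flash

variable {d : ℕ} {h : ℕ → ℕ}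

theorem hitTime_eq_congr {L L' : Set (V d)} (hL : L = L') {s s' : ℕ → V d} {t : ℕ}
    (hs : ∀ u ≤ t, s u = s' u) : hitTime L s = t ↔ hitTime L' s' = t := by
  subst hL
  rw [hitTime, hitTime, firstTime_eq_coe_iff, firstTime_eq_coe_iff, hs t le_rfl]
  exact and_congr_right fun _ => forall₂_congr fun u hu => by rw [hs u hu.le]

theorem flashDelay_eq_congr {j : ℕ} {x y : Bool} {ρ : ℝ} {s s' : ℕ → V d} {t : ℕ}
    (hs : ∀ u ≤ t, s u = s' u) : flashDelay h j x y ρ s = t ↔ flashDelay h j x y ρ s' = t := by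
  unfold flashDelay
  split_ifs
  · exact Iff.rfl
  · exact hitTime_eq_congr (by rw [hs 0 (Nat.zero_le t)]) hs
  · exact hitTime_eq_congr rfl hs

theorem mem_flashTimes_iff {s : ℕ → V d} {x y : ℕ → Bool} {ρ : ℕ → ℝ} {t : ℕ} :
    t ∈ flashTimes h s x y ρ ↔ ∃ j u v : ℕ, hitTime (midSphere d h j) s = (u : ℕ∞) ∧
      flashDelay h j (x j) (y j) (ρ j) (fun v => s (u + v)) = (v : ℕ∞) ∧ u + v = t ∧
      s t ∈ cell h j (s u) := by
  constructor
  · rintro ⟨j, u, h1, h2, h3⟩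
    have hne : flashDelay h j (x j) (y j) (ρ j) (fun v => s (u + v)) ≠ ⊤ := by
      intro hT
      rw [hT, add_top] at h2
      exact ENat.top_ne_natCast t h2
    obtain ⟨v, hv⟩ := ENat.ne_top_iff_exists.1 hne
    rw [← hv] at h2
    exact ⟨j, u, v, h1, hv.symm, by exact_mod_cast h2, h3⟩
  · rintro ⟨j, u, v, h1, h2, rfl, h3⟩
    exact ⟨j, u, h1, by rw [h2]; push_cast; rfl, h3⟩

/-- Flashing times are adapted to the trajectory. -/
theorem mem_flashTimes_congr {s s' : ℕ → V d} {x y : ℕ → Bool} {ρ : ℕ → ℝ} {t : ℕ}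
    (hs : ∀ u ≤ t, s u = s' u) : t ∈ flashTimes h s x y ρ ↔ t ∈ flashTimes h s' x y ρ := by
  rw [mem_flashTimes_iff, mem_flashTimes_iff]
  refine exists_congr fun j => exists_congr fun u => exists_congr fun v => ?_
  by_cases huv : u + v = t
  · rw [hitTime_eq_congr rfl fun w hw => hs w (by omega),
      flashDelay_eq_congr fun w hw => hs (u + w) (by omega), hs t le_rfl, hs u (by omega)]
  · simp [huv]

theorem measurable_emb : Measurable (emb (d := d)) := Measurable.of_discrete

section FlashMeasurable

variable {Ω : Type*} [MeasurableSpace Ω] {s : Ω → ℕ → V d}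

theorem measurable_hitTime (L : Set (V d)) (hs : ∀ t, Measurable fun ω => s ω t) :
    Measurable fun ω => hitTime L (s ω) :=
  measurable_firstTime fun t => hs t MeasurableSet.of_discrete

theorem measurableSet_mem_dBall {a b : Ω → V d} {r : Ω → ℝ} (ha : Measurable a)
    (hb : Measurable b) (hr : Measurable r) : MeasurableSet {ω | a ω ∈ dBall (b ω) (r ω)} :=
  measurableSet_lt ((measurable_emb.comp ha).sub (measurable_emb.comp hb)).norm hr

theorem measurable_flashDelay {j : ℕ} {x y : Ω → Bool} {ρ : Ω → ℝ}
    (hs : ∀ t, Measurable fun ω => s ω t) (hx : Measurable x) (hy : Measurable y)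
    (hρ : Measurable ρ) : Measurable fun ω => flashDelay h j (x ω) (y ω) (ρ ω) (s ω) := by
  unfold flashDelay
  refine Measurable.ite (hx (measurableSet_singleton true)) measurable_const
    (Measurable.ite (hy (measurableSet_singleton true)) ?_ ?_)
  · refine measurable_firstTime fun t => (measurableSet_mem_dBall (hs t) (hs 0) ?_).compl
    exact hρ.min (measurable_const.sub (measurable_emb.comp (hs 0)).norm)
  · refine measurable_firstTime fun t => MeasurableSet.compl ?_
    exact (measurableSet_mem_dBall (hs t) measurable_const (measurable_const.add hρ)).diff
      (measurableSet_mem_dBall (hs t) measurable_const (measurable_const.sub hρ))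

theorem measurableSet_mem_flashTimes {x y : Ω → ℕ → Bool} {ρ : Ω → ℕ → ℝ}
    (hs : ∀ t, Measurable fun ω => s ω t) (hx : ∀ j, Measurable fun ω => x ω j)
    (hy : ∀ j, Measurable fun ω => y ω j) (hρ : ∀ j, Measurable fun ω => ρ ω j) (t : ℕ) :
    MeasurableSet {ω | t ∈ flashTimes h (s ω) (x ω) (y ω) (ρ ω)} := by
  have : {ω | t ∈ flashTimes h (s ω) (x ω) (y ω) (ρ ω)} = ⋃ j : ℕ, ⋃ u : ℕ, ⋃ v : ℕ,
      ({ω | hitTime (midSphere d h j) (s ω) = (u : ℕ∞)} ∩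
        {ω | flashDelay h j (x ω j) (y ω j) (ρ ω j) (fun v => s ω (u + v)) = (v : ℕ∞)}) ∩
      ({ω | u + v = t} ∩ {ω | (s ω t, s ω u) ∈ {q : V d × V d | q.1 ∈ cell h j q.2}}) := by
    ext ω
    simp only [Set.mem_ofPred_eq, mem_flashTimes_iff, Set.mem_iUnion, Set.mem_inter_iff, and_assoc]
  rw [this]
  refine MeasurableSet.iUnion fun j => MeasurableSet.iUnion fun u => MeasurableSet.iUnion fun v =>
    MeasurableSet.inter (MeasurableSet.inter ?_ ?_) (MeasurableSet.inter (MeasurableSet.const _) ?_)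
  · exact measurable_hitTime _ hs (measurableSet_singleton _)
  · exact measurable_flashDelay (fun v => hs (u + v)) (hx j) (hy j) (hρ j)
      (measurableSet_singleton _)
  · exact ((hs t).prodMk (hs u)) MeasurableSet.of_discrete

end FlashMeasurable

/-! ### Flashing far from the origin -/

theorem natCast_le_shellRadius (hh : ∀ n, 0 < h n) (j : ℕ) : (j : ℝ) ≤ shellRadius h j := by
  induction j with
  | zero => simp [shellRadius]
  | succ j ih =>
    rw [shellRadius]
    have h1 : (1 : ℝ) ≤ h (j + 1) := by exact_mod_cast hh (j + 1)
    have h2 : (0 : ℝ) ≤ h j := by positivity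
    push_cast
    linarith

theorem natCast_le_shellRadius_sub (hh : ∀ n, 0 < h n) (j : ℕ) :
    (j : ℝ) ≤ shellRadius h (j + 1) - h (j + 1) := by
  have h1 := natCast_le_shellRadius hh j
  have h2 : (0 : ℝ) ≤ h j := by positivity
  rw [shellRadius]
  linarith

/-- Nearest-neighbour trajectories from the origin visiting sites arbitrarily far away. -/
structure Wanders (s : ℕ → V d) : Prop where
  start : s 0 = 0
  nbr : ∀ t, Nbr (s (t + 1)) (s t)
  unbounded : ∀ r : ℝ, ∃ t, r ≤ ‖emb (s t)‖

theorem Wanders.norm_le {s : ℕ → V d} (hs : Wanders s) (t : ℕ) : ‖emb (s t)‖ ≤ t := by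
  induction t with
  | zero => simp [hs.start, emb_zero]
  | succ t ih =>
    have h1 : ‖emb (s (t + 1)) - emb (s t)‖ = 1 := hs.nbr t
    have h2 := norm_le_norm_add_norm_sub' (emb (s (t + 1))) (emb (s t))
    push_cast
    linarith

/-- A wandering trajectory leaves, after any time `u`, every ball around its site at time `u`. The
site of exit is within distance one of the ball. -/
theorem Wanders.exists_exit {s : ℕ → V d} (hs : Wanders s) (u : ℕ) {r : ℝ} :
    ∃ v : ℕ, hitTime (dBall (s u) r)ᶜ (fun v => s (u + v)) = v ∧
      (r ≤ 0 ∧ v = 0 ∨ ‖emb (s (u + v)) - emb (s u)‖ < r + 1) := by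
  -- The bound `u` on the norm makes the visit later than `u`, a trajectory having unit speed.
  obtain ⟨t, ht⟩ := hs.unbounded (max (r + ‖emb (s u)‖) u)
  have hut : u ≤ t := by
    have h1 := (le_max_right _ _).trans ht
    exact_mod_cast h1.trans (hs.norm_le t)
  have hex : hitTime (dBall (s u) r)ᶜ (fun v => s (u + v)) ≠ ⊤ := by
    refine firstTime_ne_top_iff.2 ⟨t - u, fun hlt => ?_⟩
    have hlt' : ‖emb (s (u + (t - u))) - emb (s u)‖ < r := hlt
    rw [Nat.add_sub_cancel' hut] at hlt'
    have h1 := (le_max_left _ _).trans ht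
    have h2 := norm_le_norm_add_norm_sub' (emb (s t)) (emb (s u))
    linarith
  obtain ⟨v, hv⟩ := ENat.ne_top_iff_exists.1 hex
  refine ⟨v, hv.symm, ?_⟩
  obtain ⟨h1, h2⟩ := firstTime_eq_coe_iff.1 hv.symm
  rcases v with _ | v
  · left
    refine ⟨?_, rfl⟩
    simpa [dBall] using h1
  · right
    have h3 : ‖emb (s (u + v)) - emb (s u)‖ < r := by
      simpa [dBall] using h2 v (by omega)
    have h4 : ‖emb (s (u + v + 1)) - emb (s (u + v))‖ = 1 := hs.nbr _
    have h5 := norm_sub_le_norm_sub_add_norm_sub (emb (s (u + v + 1))) (emb (s (u + v)))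
      (emb (s u))
    rw [← add_assoc]
    linarith

/-- Crossing the sphere `Σ_{j+1}` is unavoidable for a nearest-neighbour trajectory, and its sites
are at distance less than one from the ball that it bounds. -/
theorem Wanders.exists_hit_midSphere {s : ℕ → V d} (hs : Wanders s) (hh : ∀ n, 0 < h n) (j : ℕ) :
    ∃ u : ℕ, hitTime (midSphere d h (j + 1)) s = u ∧
      shellRadius h (j + 1) ≤ ‖emb (s u)‖ ∧ ‖emb (s u)‖ < shellRadius h (j + 1) + 1 := by
  set r := shellRadius h (j + 1) with hr
  have hr0 : 0 < r := by
    have := natCast_le_shellRadius hh (j + 1)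
    have h1 : (0 : ℝ) < ((j + 1 : ℕ) : ℝ) := by positivity
    linarith
  have hball : ∀ z : V d, z ∈ dBall 0 r ↔ ‖emb z‖ < r := fun z => by
    simp [dBall, emb_zero]
  have hex : ∃ t, s t ∈ midSphere d h (j + 1) := by
    have hne : ∃ t, r ≤ ‖emb (s t)‖ := hs.unbounded r
    classical
    obtain ⟨t, ht, hmin⟩ : ∃ t, r ≤ ‖emb (s t)‖ ∧ ∀ u < t, ‖emb (s u)‖ < r :=
      ⟨Nat.find hne, Nat.find_spec hne, fun u hu => not_le.1 (Nat.find_min hne hu)⟩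
    rcases t with _ | t
    · rw [hs.start, emb_zero, norm_zero] at ht
      linarith
    · refine ⟨t + 1, (hball _).not.2 (not_lt.2 ht), s t, (hball _).2 (hmin t (by omega)), ?_⟩
      have : ‖emb (s (t + 1)) - emb (s t)‖ = 1 := hs.nbr t
      rwa [Nbr, norm_sub_rev]
  obtain ⟨u, hu⟩ := ENat.ne_top_iff_exists.1 (firstTime_ne_top_iff.2 hex)
  refine ⟨u, hu.symm, ?_⟩
  obtain ⟨h1, z, hz, hzu⟩ := (firstTime_eq_coe_iff.1 hu.symm).1
  refine ⟨not_lt.1 ((hball _).not.1 h1), ?_⟩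
  have h2 := (hball z).1 hz
  have h3 : ‖emb z - emb (s u)‖ = 1 := hzu
  have h4 := norm_le_norm_add_norm_sub (emb z) (emb (s u))
  linarith

/-- A sufficient condition on the flags and the radius of shell `j` for the explorer to flash there:
either it flashes where it hits the sphere, or it flashes on leaving a ball of radius at most a
quarter of the width. -/
def Triggers (h : ℕ → ℕ) (j : ℕ) (m : Bool × Bool × ℝ) : Prop :=
  m.1 = true ∨ (8 ≤ h j ∧ m.2.1 = true ∧ m.2.2 ≤ (h j : ℝ) / 4)

/-- Sites of a shell that are close to a center belong to its cell, the cone of the cell containing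
the ball that generates it. -/
theorem mem_cell_of_close {j : ℕ} {x z : V d} (h1 : shellRadius h j - h j ≤ ‖emb x‖)
    (h2 : ‖emb x‖ < shellRadius h j + h j) (h3 : ‖emb x - emb z‖ < (h j : ℝ) / 2) :
    x ∈ cell h j z := by
  refine ⟨⟨?_, ?_⟩, 1, zero_le_one, emb x, ?_, (one_smul ℝ _).symm⟩
  · simpa [dBall, emb_zero] using h2
  · simpa [dBall, emb_zero] using h1
  · rwa [mem_ball_iff_norm]

/-- A radius of at most a quarter of the width makes the explorer stop close enough to its hitting
site for the flashing site to lie in the cell. -/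
theorem Wanders.exists_mem_flashTimes {s : ℕ → V d} (hs : Wanders s) (hh : ∀ n, 0 < h n) {j : ℕ}
    {x y : ℕ → Bool} {ρ : ℕ → ℝ} (hT : Triggers h (j + 1) (x (j + 1), y (j + 1), ρ (j + 1))) :
    ∃ t ∈ flashTimes h s x y ρ, (j : ℝ) ≤ ‖emb (s t)‖ := by
  obtain ⟨u, hu, hr1, hr2⟩ := hs.exists_hit_midSphere hh j
  have hj := natCast_le_shellRadius_sub hh j
  have hpos : (1 : ℝ) ≤ h (j + 1) := by exact_mod_cast hh (j + 1)
  have hself : s u ∈ cell h (j + 1) (s u) :=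
    mem_cell_of_close (by linarith) (by linarith) (by rw [sub_self, norm_zero]; linarith)
  have far : ∀ {t}, s t ∈ cell h (j + 1) (s u) → (j : ℝ) ≤ ‖emb (s t)‖ := by
    intro t ht
    have : shellRadius h (j + 1) - h (j + 1) ≤ ‖emb (s t)‖ := by
      simpa [dBall, emb_zero] using ht.1.2
    linarith
  by_cases hx : x (j + 1) = true
  · refine ⟨u, mem_flashTimes_iff.2 ⟨j + 1, u, 0, hu, ?_, rfl, hself⟩, far hself⟩
    simp [flashDelay, hx]
  · obtain ⟨h8, hy, hρ⟩ := hT.resolve_left hx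
    have h8' : (8 : ℝ) ≤ h (j + 1) := by exact_mod_cast h8
    simp only at hy hρ
    obtain ⟨v, hv, hexit⟩ := hs.exists_exit u (r := min (ρ (j + 1))
      (shellRadius h (j + 1) + h (j + 1) - ‖emb (s u)‖))
    have hcell : s (u + v) ∈ cell h (j + 1) (s u) := by
      rcases hexit with ⟨-, rfl⟩ | hexit
      · exact hself
      · -- The site of exit is within `h / 4 + 1 ≤ h / 2` of the center since `8 ≤ h`.
        have h1 := min_le_left (ρ (j + 1)) (shellRadius h (j + 1) + h (j + 1) - ‖emb (s u)‖)
        have h2 := norm_le_norm_add_norm_sub' (emb (s (u + v))) (emb (s u))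
        have h3 := norm_le_norm_add_norm_sub (emb (s (u + v))) (emb (s u))
        exact mem_cell_of_close (by linarith) (by linarith) (by linarith)
    refine ⟨u + v, mem_flashTimes_iff.2 ⟨j + 1, u, v, hu, ?_, rfl, hcell⟩, far hcell⟩
    rw [flashDelay, if_neg hx, if_pos hy]
    exact hv

/-- An explorer that is made to flash in infinitely many shells settles outside of any finite set
of occupied sites. -/
theorem Wanders.settleTime_ne_top {s : ℕ → V d} (hs : Wanders s) (hh : ∀ n, 0 < h n)
    {x y : ℕ → Bool} {ρ : ℕ → ℝ}
    (hT : ∃ᶠ j in Filter.atTop, Triggers h (j + 1) (x (j + 1), y (j + 1), ρ (j + 1)))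
    {A : Set (V d)} (hA : A.Finite) : settleTime s (flashTimes h s x y ρ) A ≠ ⊤ := by
  refine firstTime_ne_top_iff.2 ?_
  obtain ⟨r, hr⟩ := (hA.image fun z => ‖emb z‖).bddAbove
  obtain ⟨n, hn⟩ := exists_nat_gt r
  obtain ⟨j, hjn, hj⟩ := Filter.frequently_atTop.1 hT n
  obtain ⟨t, ht, hfar⟩ := hs.exists_mem_flashTimes hh hj
  refine ⟨t, ht, fun hmem => ?_⟩
  have h1 := hr ⟨s t, hmem, rfl⟩
  have h2 : (n : ℝ) ≤ j := by exact_mod_cast hjn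
  simp only at h1
  linarith

end Flash

/-! ### The laws of the flags and of the radii -/

section Marks

variable (d : ℕ) (h : ℕ → ℕ) (j : ℕ)

theorem coe_toNNReal_unitInterval (p : unitInterval) :
    ((unitInterval.toNNReal p : NNReal) : ENNReal) = ENNReal.ofReal p := by
  rw [ENNReal.ofReal, Real.toNNReal_of_nonneg p.2.1]
  rfl

instance : IsProbabilityMeasure (lawX d h j) := by unfold lawX; infer_instance

instance : IsProbabilityMeasure (lawY j) := by cases j <;> (unfold lawY; infer_instance)

variable {d h j}

theorem setLIntegral_radius_density (hd : 0 < d) (hh : 0 < h j) {b : ℝ} (hb : 0 ≤ b) :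
    ∫⁻ a in Set.Icc 0 b, ENNReal.ofReal ((d : ℝ) * a ^ (d - 1) / (h j : ℝ) ^ d) =
      ENNReal.ofReal ((b / h j) ^ d) := by
  rw [← ofReal_integral_eq_lintegral_ofReal]
  · congr 1
    rw [integral_Icc_eq_integral_Ioc, ← intervalIntegral.integral_of_le hb,
      intervalIntegral.integral_div, intervalIntegral.integral_const_mul, integral_pow]
    have hd' : d - 1 + 1 = d := by omega
    have hc : ((d - 1 : ℕ) : ℝ) + 1 = d := by exact_mod_cast hd'
    rw [hd', hc, zero_pow hd.ne', sub_zero, div_pow]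
    have : (d : ℝ) ≠ 0 := by positivity
    field_simp
  · exact (Continuous.continuousOn (by fun_prop)).integrableOn_Icc
  · filter_upwards [ae_restrict_mem measurableSet_Icc] with a ha
    have := ha.1
    simp only [Pi.zero_apply]
    positivity

theorem lawR_Iic (hd : 0 < d) (hh : 0 < h j) {b : ℝ} (hb : 0 ≤ b) (hbh : b ≤ h j) :
    lawR d h j (Set.Iic b) = ENNReal.ofReal ((b / h j) ^ d) := by
  have : Set.Iic b ∩ Set.Icc 0 (h j : ℝ) = Set.Icc 0 b := by
    ext a
    simp only [Set.mem_inter_iff, Set.mem_Iic, Set.mem_Icc]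
    exact ⟨fun ⟨h1, h2, _⟩ => ⟨h2, h1⟩, fun ⟨h1, h2⟩ => ⟨h2, h1, h2.trans hbh⟩⟩
  rw [lawR, withDensity_apply _ measurableSet_Iic, Measure.restrict_restrict measurableSet_Iic,
    this, setLIntegral_radius_density hd hh hb]

theorem isProbabilityMeasure_lawR (hd : 0 < d) (hh : 0 < h j) :
    IsProbabilityMeasure (lawR d h j) := by
  constructor
  have : (h j : ℝ) ≠ 0 := by positivity
  rw [lawR, withDensity_apply _ MeasurableSet.univ, Measure.restrict_univ,
    setLIntegral_radius_density hd hh (Nat.cast_nonneg _), div_self this]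
  simp

theorem measurableSet_triggers : MeasurableSet {m | Triggers h j m} := by
  have : {m | Triggers h j m} = Prod.fst ⁻¹' {true} ∪ ({m : Bool × Bool × ℝ | 8 ≤ h j} ∩
      ((fun m => m.2.1) ⁻¹' {true} ∩ (fun m => m.2.2) ⁻¹' Set.Iic ((h j : ℝ) / 4))) := by
    ext m
    rfl
  rw [this]
  measurability

/-- Flashing in a shell has a probability bounded below: flashing at once is likely enough in narrow
shells, and small radii are in wide shells. -/
theorem le_measure_triggers (hd : 0 < d) (hh : ∀ n, 0 < h n) (j : ℕ) :
    ENNReal.ofReal ((8 ^ d : ℝ)⁻¹ / 2) ≤ (lawX d h (j + 1)).prod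
      ((lawY (j + 1)).prod (lawR d h (j + 1))) {m | Triggers h (j + 1) m} := by
  have := isProbabilityMeasure_lawR (h := h) (j := j + 1) hd (hh _)
  have hpos : (0 : ℝ) < h (j + 1) := by exact_mod_cast hh (j + 1)
  by_cases h8 : 8 ≤ h (j + 1)
  · have hsub : Set.univ ×ˢ ({true} ×ˢ Set.Iic ((h (j + 1) : ℝ) / 4)) ⊆
        {m | Triggers h (j + 1) m} := fun m hm => Or.inr ⟨h8, hm.2.1, hm.2.2⟩
    refine le_trans ?_ (measure_mono hsub)
    rw [Measure.prod_prod, Measure.prod_prod, measure_univ, one_mul,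
      lawR_Iic hd (hh _) (by positivity) (by linarith)]
    have hY : lawY (j + 1) {true} = ENNReal.ofReal (1 / 2) := by
      rw [lawY, bernoulliMeasure_apply_of_mem_of_notMem _ (measurableSet_singleton _) (by simp)
        (by simp)]
      exact coe_toNNReal_unitInterval _
    rw [hY, ← ENNReal.ofReal_mul (by norm_num)]
    refine ENNReal.ofReal_le_ofReal ?_
    rw [div_div, mul_comm (4 : ℝ), ← div_div, div_self hpos.ne', one_div_pow]
    have : ((8 : ℝ) ^ d)⁻¹ ≤ 1 / 4 ^ d := by
      rw [one_div]
      gcongr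
      norm_num
    linarith
  · have hsub : {true} ×ˢ Set.univ ⊆ {m | Triggers h (j + 1) m} := fun m hm => Or.inl hm.1
    refine le_trans ?_ (measure_mono hsub)
    have hX : lawX d h (j + 1) {true} = ENNReal.ofReal (((h (j + 1) : ℝ) ^ d)⁻¹) := by
      rw [lawX, bernoulliMeasure_apply_of_mem_of_notMem _ (measurableSet_singleton _) (by simp)
        (by simp)]
      exact coe_toNNReal_unitInterval _
    rw [Measure.prod_prod, measure_univ, mul_one, hX]
    refine ENNReal.ofReal_le_ofReal ?_
    have h8' : (h (j + 1) : ℝ) ≤ 8 := by exact_mod_cast (not_le.1 h8).le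
    have h1 : ((8 : ℝ) ^ d)⁻¹ ≤ ((h (j + 1) : ℝ) ^ d)⁻¹ := by gcongr
    have h2 : (0 : ℝ) ≤ ((8 : ℝ) ^ d)⁻¹ := by positivity
    linarith

end Marks

/-! ### The coupling -/

section Coupling

variable {d N : ℕ}

/-- The flags and radii of all explorers. -/
abbrev Marks (N : ℕ) : Type := Fin N × ℕ → Bool × Bool × ℝ

/-- The laws of the flags and of the radius of an explorer in shell `j`. -/
def lawMark (d : ℕ) (h : ℕ → ℕ) (j : ℕ) : Measure (Bool × Bool × ℝ) :=
  (lawX d h j).prod ((lawY j).prod (lawR d h j))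

theorem isProbabilityMeasure_lawMark (hd : 0 < d) {h : ℕ → ℕ} (hh : ∀ n, 0 < h n) (j : ℕ) :
    IsProbabilityMeasure (lawMark d h j) := by
  have := isProbabilityMeasure_lawR (h := h) (j := j) hd (hh j)
  unfold lawMark
  infer_instance

/-- The flashing times, as a rule giving allowed times. -/
def flashRule (h : ℕ → ℕ) (s : Fin N → ℕ → V d) (m : Marks N) (i : Fin N) : Set ℕ :=
  flashTimes h (s i) (fun j => (m (i, j)).1) (fun j => (m (i, j)).2.1) (fun j => (m (i, j)).2.2)

theorem adapted_flashRule (h : ℕ → ℕ) : Adapted (flashRule (d := d) (N := N) h) :=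
  fun _ _ _ _ _ hs => mem_flashTimes_congr hs

theorem measurableSet_mem_times_flashRule (h : ℕ → ℕ) (i : Fin N) (t : ℕ) :
    MeasurableSet {ω : (StepIndex N → V d) × Marks N | t ∈ times (flashRule h) ω i} := by
  refine measurableSet_mem_flashTimes (s := fun ω : (StepIndex N → V d) × Marks N =>
    leftWalk ω.1 i) (fun t => (measurable_leftWalk i t).comp measurable_fst) ?_ ?_ ?_ t <;>
  · intro j
    fun_prop

variable {Ω : Type*} [MeasurableSpace Ω] {P : Measure Ω}

/-- Independent uniform steps make a family of independent simple random walks. -/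
theorem isWalkFamily_walk {μ : Measure (V d)} [IsProbabilityMeasure μ]
    (hμ : μ = uniformOn {e : V d | Nbr e 0}) {x : Ω → Fin N × ℕ → V d}
    (hx : MeasurePreserving x P (Measure.infinitePi fun _ => μ)) :
    IsWalkFamily P fun i t ω => walk (x ω) i t := by
  have hP : IsProbabilityMeasure P := by
    refine ⟨?_⟩
    rw [← Set.preimage_univ (f := x), hx.measure_preimage MeasurableSet.univ.nullMeasurableSet,
      measure_univ]
  have hlaw : ∀ p : Fin N × ℕ, P.map (fun ω => x ω p) = μ := by
    intro p
    have h := (measurePreserving_eval_infinitePi (fun _ : Fin N × ℕ => μ) p).comp hx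
    exact h.map_eq
  have hm : ∀ p : Fin N × ℕ, Measurable fun ω => x ω p := fun p =>
    (measurable_pi_apply p).comp hx.measurable
  refine ⟨fun i t => ?_, fun i ω => walk_zero _ i, fun i t => ?_, ?_⟩
  · unfold walk
    exact Finset.measurable_sum _ fun u _ => hm _
  · simp only [walk_succ_sub, hlaw, hμ]
  · simp only [walk_succ_sub]
    rw [iIndepFun_iff_map_fun_eq_infinitePi_map (by fun_prop)]
    simp only [hlaw]
    exact hx.map_eq

theorem measurePreserving_comp_injective {ι κ β : Type*} [MeasurableSpace β] {μ : Measure β}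
    [IsProbabilityMeasure μ] {f : κ → ι} (hf : Function.Injective f) :
    MeasurePreserving (fun (x : ι → β) k => x (f k)) (Measure.infinitePi fun _ => μ)
      (Measure.infinitePi fun _ => μ) :=
  ⟨by fun_prop, Measure.map_infinitePi_infinitePi_of_inj (P := fun _ : ι => μ) hf⟩

/-- Almost surely every explorer of the flashing process settles, whatever the finite set of
occupied sites. -/
theorem ae_settleTime_flashTimes_ne_top (hd : 0 < d) {h : ℕ → ℕ} (hh : ∀ n, 0 < h n)
    {S : Fin N → ℕ → Ω → V d} {X Y : Fin N → ℕ → Ω → Bool} {R : Fin N → ℕ → Ω → ℝ}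
    (hin : IsFlashingInput h P S X Y R) :
    ∀ᵐ ω ∂P, ∀ i, ∀ A : Set (V d), A.Finite → settleTime (fun t => S i t ω)
      (flashTimes h (fun t => S i t ω) (fun j => X i j ω) (fun j => Y i j ω)
        (fun j => R i j ω)) A ≠ ⊤ := by
  have hT : ∀ᵐ ω ∂P, ∀ i, ∃ᶠ j in Filter.atTop,
      Triggers h (j + 1) (X i (j + 1) ω, Y i (j + 1) ω, R i (j + 1) ω) := by
    rw [ae_all_iff]
    intro i
    have hm : ∀ j, Measurable fun ω => (X i (j + 1) ω, Y i (j + 1) ω, R i (j + 1) ω) := fun j =>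
      (hin.measurable_X i _).prodMk ((hin.measurable_Y i _).prodMk (hin.measurable_R i _))
    have hI : iIndepFun (fun (j : ℕ) ω => (X i (j + 1) ω, Y i (j + 1) ω, R i (j + 1) ω)) P :=
      iIndepFun.precomp (g := fun j : ℕ => (i, j + 1)) (fun a b hab => by simpa using hab)
        hin.indep
    refine ae_frequently_mem_of_iIndepSet (fun j => hm j measurableSet_triggers)
      (iIndepSet_preimage_of_iIndepFun hI hm fun _ => measurableSet_triggers)
      (c := ENNReal.ofReal ((8 ^ d : ℝ)⁻¹ / 2)) ?_ fun j => ?_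
    · rw [Ne, ENNReal.ofReal_eq_zero, not_le]
      positivity
    · refine (le_measure_triggers hd hh j).trans ?_
      rw [← hin.law i (j + 1), Measure.map_apply (hm j) measurableSet_triggers]
      exact le_rfl
  filter_upwards [hT, hin.walks.ae_nbr, hin.walks.ae_unbounded hd] with ω h1 h2 h3 i A hA
  exact Wanders.settleTime_ne_top (s := fun t => S i t ω) ⟨hin.walks.start i ω, h2 i, h3 i⟩ hh
    (h1 i) hA

/-- Product measure gives the random input of the flashing process. -/
theorem isFlashingInput_prod (hd : 0 < d) {h : ℕ → ℕ} (hh : ∀ n, 0 < h n) {μ : Measure (V d)}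
    [IsProbabilityMeasure μ] (hμ : μ = uniformOn {e : V d | Nbr e 0}) :
    IsFlashingInput h ((Measure.infinitePi fun _ : StepIndex N => μ).prod
        (Measure.infinitePi fun q : Fin N × ℕ => lawMark d h q.2))
      (fun i t ω => leftWalk ω.1 i t) (fun i j ω => (ω.2 (i, j)).1)
      (fun i j ω => (ω.2 (i, j)).2.1) (fun i j ω => (ω.2 (i, j)).2.2) := by
  have hν : ∀ q : Fin N × ℕ, IsProbabilityMeasure (lawMark d h q.2) := fun q =>
    isProbabilityMeasure_lawMark hd hh q.2
  set P := (Measure.infinitePi fun _ : StepIndex N => μ).prod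
    (Measure.infinitePi fun q : Fin N × ℕ => lawMark d h q.2)
  have hsnd : MeasurePreserving Prod.snd P
      (Measure.infinitePi fun q : Fin N × ℕ => lawMark d h q.2) := measurePreserving_snd
  have hlaw : ∀ q : Fin N × ℕ, P.map (fun ω => ω.2 q) = lawMark d h q.2 := fun q =>
    ((measurePreserving_eval_infinitePi (fun q : Fin N × ℕ => lawMark d h q.2) q).comp hsnd).map_eq
  refine ⟨?_, fun i j => by fun_prop, fun i j => by fun_prop, fun i j => by fun_prop,
    fun i j => hlaw (i, j), ?_, ?_⟩
  · exact isWalkFamily_walk hμ ((measurePreserving_comp_injective Sum.inl_injective).comp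
      measurePreserving_fst)
  · change iIndepFun (fun (p : Fin N × ℕ) ω => ω.2 p) P
    rw [iIndepFun_iff_map_fun_eq_infinitePi_map (by fun_prop)]
    simp only [hlaw]
    exact hsnd.map_eq
  · refine indepFun_prod (X := fun x : StepIndex N → V d => fun i t => leftWalk x i t)
      (Y := fun (m : Marks N) i j => m (i, j)) ?_ (by fun_prop)
    exact measurable_pi_lambda _ fun i => measurable_pi_lambda _ fun t => measurable_leftWalk i t

end Coupling

end FlashDLA

end

theorem mainTheorem4 (d N : ℕ) (hd : 0 < d) (h : ℕ → ℕ) (hh : ∀ n, 0 < h n) :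
    ∃ (Ω : Type) (_ : MeasurableSpace Ω) (P : Measure Ω)
      (W S : Fin N → ℕ → Ω → FlashDLA.V d)
      (X Y : Fin N → ℕ → Ω → Bool) (R : Fin N → ℕ → Ω → ℝ)
      (T Tstar : Fin N → Ω → ℕ),
      IsProbabilityMeasure P ∧
      FlashDLA.IsWalkFamily P W ∧
      FlashDLA.IsFlashingInput h P S X Y R ∧
      (∀ i, Measurable (T i)) ∧ (∀ i, Measurable (Tstar i)) ∧
      ∀ᵐ ω ∂P,
        (∀ i, FlashDLA.idlaTime (fun i t => W i t ω) i ≠ ⊤) ∧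
        FlashDLA.SameSteps (fun i t => W i t ω) (FlashDLA.idlaTime (fun i t => W i t ω))
          (fun i t => S i t ω) (fun i => T i ω) ∧
        FlashDLA.idlaCluster (fun i t => W i t ω) N = ⋃ i, {S i (T i ω) ω} ∧
        (∀ i, FlashDLA.flashTime h (fun i t => S i t ω) (fun i j => X i j ω)
          (fun i j => Y i j ω) (fun i j => R i j ω) i = (Tstar i ω : ℕ∞)) ∧
        FlashDLA.flashCluster h (fun i t => S i t ω) (fun i j => X i j ω)
          (fun i j => Y i j ω) (fun i j => R i j ω) N = ⋃ i, {S i (Tstar i ω) ω} ∧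
        ∀ i, T i ω ≤ Tstar i ω := by
  open FlashDLA in
  let μ : Measure (V d) := uniformOn {e : V d | Nbr e 0}
  have hμ : IsProbabilityMeasure μ := isProbabilityMeasure_uniformOn_nbr hd
  have hν : ∀ q : Fin N × ℕ, IsProbabilityMeasure (lawMark d h q.2) := fun q =>
    isProbabilityMeasure_lawMark hd hh q.2
  let P : Measure ((StepIndex N → V d) × Marks N) :=
    (Measure.infinitePi fun _ : StepIndex N => μ).prod
      (Measure.infinitePi fun q : Fin N × ℕ => lawMark d h q.2)
  have hin := isFlashingInput_prod (N := N) hd hh (μ := μ) rfl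
  have hA : Adapted (flashRule (d := d) (N := N) h) := adapted_flashRule h
  have hAm := measurableSet_mem_times_flashRule (d := d) (N := N) h
  have hSm : ∀ (i : Fin N) (t : ℕ),
      Measurable fun ω : (StepIndex N → V d) × Marks N => leftWalk ω.1 i t :=
    fun i t => (measurable_leftWalk i t).comp measurable_fst
  have hfin : ∀ᵐ ω ∂P, ∀ i, settlingTime (leftWalk ω.1) (times (flashRule h) ω) i ≠ ⊤ := by
    filter_upwards [ae_settleTime_flashTimes_ne_top hd hh hin] with ω hω i
    exact hω i _ (cluster_finite _ _ _)
  have hpres := measurePreserving_finalRearrange hA hAm hfin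
  -- The state in which the exploration ends; `T i` is the time reached on trajectory `i`.
  let final : (StepIndex N → V d) × Marks N → State N := fun ω =>
    explore (leftWalk ω.1) (times (flashRule h) ω)
      (explorationTime (leftWalk ω.1) (times (flashRule h) ω))
  have hfinal : Measurable final := measurable_eval_of_countable
    (fun n => measurable_explore hSm hAm n) (measurable_explorationTime hSm hAm)
  refine ⟨(StepIndex N → V d) × Marks N, inferInstance, P,
    fun i t ω => rightWalk (finalRearrange (flashRule h) ω).1 i t,
    fun i t ω => leftWalk ω.1 i t, fun i j ω => (ω.2 (i, j)).1, fun i j ω => (ω.2 (i, j)).2.1,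
    fun i j ω => (ω.2 (i, j)).2.2, fun i ω => (final ω).2.1 i,
    fun i ω => (settlingTime (leftWalk ω.1) (times (flashRule h) ω) i).toNat,
    inferInstance, ?_, hin, fun i => ?_, fun i => ?_, ?_⟩
  · exact isWalkFamily_walk rfl ((measurePreserving_comp_injective Sum.inr_injective).comp
      (measurePreserving_fst.comp hpres))
  · exact (measurable_pi_apply i).comp ((measurable_fst.comp measurable_snd).comp hfinal)
  · exact Measurable.of_discrete.comp (measurable_settlingTime hSm hAm i)
  · -- From here on the argument is deterministic: the exploration has terminated at `final ω`.
    filter_upwards [hfin] with ω hω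
    have hdone : (final ω).1 = N := explore_explorationTime hω
    have hs0 : ∀ i, leftWalk ω.1 i 0 = 0 := fun i => walk_zero _ i
    have hw0 : ∀ i, rightWalk (finalRearrange (flashRule h) ω).1 i 0 = 0 := fun i => walk_zero _ i
    have hM := matches_finalRearrange hω
    have hI := hM.inv hs0 hw0 (explorationTime (leftWalk ω.1) (times (flashRule h) ω))
    have hstar : ∀ i, settlingTime (leftWalk ω.1) (times (flashRule h) ω) i =
        ((settlingTime (leftWalk ω.1) (times (flashRule h) ω) i).toNat : ℕ∞) := fun i =>
      (ENat.natCast_toNat (hω i)).symm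
    refine ⟨fun i => ?_, sameSteps_of_done hM hs0 hw0 hdone, hI.full hdone, hstar,
      cluster_eq_iUnion hstar, fun i => ?_⟩
    · have := hI.settled i (hdone.symm ▸ i.2)
      exact this.symm ▸ ENat.natCast_ne_top _
    · have := hI.time_le i
      rw [hstar i] at this
      exact Nat.cast_le.1 this
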